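/- Let $\mathcal X$ be a real Hilbert space and let $g:\mathcal X\to\mathbb R$ be convex and differentiable with $\operatorname{argmin} g\neq\emptyset$. Let $\alpha,a,\beta,h>0$, $0<q<1$ and $1<p<q+1$. Let $(\delta_k)_{k\ge1}$ be a non-decreasing sequence of positive reals with $\delta_k\to+\infty$ such that - (growth condition $(\mathcal G)$) there is $c>0$ such that $\delta_{k+1}\le \dfrac{k^p}{(1+c)k^p-c(k+1)^p}\,\delta_k$ for all sufficiently large $k$; - there is $c_0>0$ such that $\delta_k^2\ge c_0k^{p-q}$ for all $k\ge1$. For $k\ge 1$ put $a_k=a(kh)^{-p}$, $d_k=\dfrac{(kh)^{q+p}}{(kh)^{q+p}+\alpha h(kh)^p+ah^2(kh)^q}$ and $\rho_k=d_k(\beta h+h^2\delta_k)$. A sequence $(x_k)_{k\ge0}$ in $\mathcal X$ is generated by (IPGA) if $x_0,x_1$ are arbitrary and, for all $k\ge1$, $$y_k=x_k+d_k\bigl(x_k-x_{k-1}+\beta h\nabla g(x_k)\bigr),\qquad x_{k+1}=\operatorname{prox}_{\rho_kg}\bigl(y_k-h^2d_ka_kx_k\bigr),$$ where $\operatorname{prox}_{\rho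 g}(z)$ is the minimizer of $w\mapsto g(w)+\frac1{2\rho}\|w-z\|^2$. Then $\operatorname{argmin}g$ has a unique element $\bar x^*$ of minimum norm, for each $k\ge1$ the function $x\mapsto g(x)+\frac{a_k}{2\delta_k}\|x\|^2$ has a unique minimizer $\bar x_k$, and every sequence $(x_k)$ generated by (IPGA) satisfies $\lim_{k\to\infty}\|x_k-\bar x^*\|=0$ and, as $k\to+\infty$: (i) If $1<p<2q$, then $$g(x_k)-g(\bar x^*)=\mathcal O\Bigl(\tfrac1{k^p\delta_k}\Bigr),\quad \|x_k-\bar x_k\|=\mathcal O\Bigl(\tfrac1{k^{(1-q)/2}}\Bigr),\quad \|\nabla g(x_k)\|=\mathcal O\Bigl(\tfrac1{k^{(p-q+1)/2}\delta_k}\Bigr),\quad \|x_k-x_{k-1}\|=\mathcal O\Bigl(\tfrac1{k^{(p-q+1)/2}}\Bigr).$$ (ii) If $2q\le p<\frac12(3q+1)$, then $$g(x_k)-g(\bar x^*)=\mathcal O\Bigl(\tfrac1{k^p\delta_k}\Bigr),\quad \|x_k-\bar x_k\|=\mathcal O\Bigl(\tfrac1{k^{(1-q)/2}}\Bigr),\quad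 \|\nabla g(x_k)\|=\mathcal O\Bigl(\tfrac1{k^{(q+1)/2}\delta_k}\Bigr),\quad \|x_k-x_{k-1}\|=\mathcal O\Bigl(\tfrac1{k^{(q+1)/2}}\Bigr).$$ (iii) If $\frac12(3q+1)\le p<q+1$, then $$\|x_k-\bar x_k\|=\mathcal O\Bigl(\tfrac1{k^{q-p+1}}\Bigr),\quad \|\nabla g(x_k)\|=\mathcal O\Bigl(\tfrac1{k^{2q-p+1}\delta_k}\Bigr),\quad \|x_k-x_{k-1}\|=\mathcal O\Bigl(\tfrac1{k^{2q-p+1}}\Bigr).$$ Further, $g(x_k)-g(\bar x^*)=\mathcal O\bigl(\tfrac1{k^p\delta_k}\bigr)$ if $\frac12(3q+1)\le p<\frac13(4q+2)$, and $g(x_k)-g(\bar x^*)=\mathcal O\bigl(\tfrac1{k^{4q-2p+2}\delta_k}\bigr)$ if $\frac13(4q+2)\le p<q+1$. -/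

import Mathlib

open Filter Topology Asymptotics

noncomputable section

/-- The solution set `argmin g` of `min_{x ∈ X} g x`. -/
def argminSet {X : Type*} (g : X → ℝ) : Set X :=
  {x | IsMinOn g Set.univ x}

/-- `z` is the minimum-norm element of `argmin g`. -/
def IsMinNormSolution {X : Type*} [NormedAddCommGroup X] (g : X → ℝ) (z : X) : Prop :=
  z ∈ argminSet g ∧ ∀ y ∈ argminSet g, ‖z‖ ≤ ‖y‖

/-- `z` is a minimizer of the Tikhonov regularized function `x ↦ g x + (ε / 2) ‖x‖²`. -/
def IsTikhonovPoint {X : Type*} [NormedAddCommGroup X] (g : X → ℝ) (ε : ℝ) (z : X) : Prop :=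
  IsMinOn (fun x => g x + ε / 2 * ‖x‖ ^ 2) Set.univ z

/-- `u = prox_{ρ g} (z)`, that is, `u` minimizes `w ↦ g w + ‖w - z‖² / (2 ρ)`. -/
def IsProx {X : Type*} [NormedAddCommGroup X] (ρ : ℝ) (g : X → ℝ) (z u : X) : Prop :=
  IsMinOn (fun w => g w + 1 / (2 * ρ) * ‖w - z‖ ^ 2) Set.univ u

/-- The Tikhonov regularization parameter `a_k = a (k h)^(-p)`. -/
def tikhonovParam (a h p : ℝ) (k : ℕ) : ℝ :=
  a * ((k : ℝ) * h) ^ (-p)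

/-- The inertial parameter
`d_k = (k h)^(q+p) / ((k h)^(q+p) + α h (k h)^p + a h² (k h)^q)`. -/
def inertialParam (α a h q p : ℝ) (k : ℕ) : ℝ :=
  ((k : ℝ) * h) ^ (q + p) /
    (((k : ℝ) * h) ^ (q + p) + α * h * ((k : ℝ) * h) ^ p + a * h ^ 2 * ((k : ℝ) * h) ^ q)

/-- The step size `ρ_k = d_k (β h + h² δ_k)`. -/
def stepSize (α a β h q p : ℝ) (δ : ℕ → ℝ) (k : ℕ) : ℝ :=
  inertialParam α a h q p k * (β * h + h ^ 2 * δ k)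

/-- The sequence `x` (with arbitrary `x 0`, `x 1`) is generated by the inertial proximal gradient
algorithm: for all `k ≥ 1`, with `y_k = x_k + d_k (x_k - x_{k-1} + β h ∇g(x_k))`,
`x_{k+1} = prox_{ρ_k g} (y_k - h² d_k a_k x_k)`. -/
def IsIPGASequence {X : Type*} [NormedAddCommGroup X] [InnerProductSpace ℝ X] [CompleteSpace X]
    (g : X → ℝ) (α a β h q p : ℝ) (δ : ℕ → ℝ) (x : ℕ → X) : Prop :=
  ∀ k : ℕ, 1 ≤ k →
    IsProx (stepSize α a β h q p δ k) g
      (x k + inertialParam α a h q p k • (x k - x (k - 1) + (β * h) • gradient g (x k))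
        - (h ^ 2 * inertialParam α a h q p k * tikhonovParam a h p k) • x k)
      (x (k + 1))

/-- The growth condition: there is `c > 0` such that
`δ_{k+1} ≤ k^p / ((1 + c) k^p - c (k+1)^p) * δ_k` for all large `k`
(the denominator is positive for all large `k`). -/
def GrowthCondition (p : ℝ) (δ : ℕ → ℝ) : Prop :=
  ∃ c : ℝ, 0 < c ∧ ∀ᶠ k : ℕ in atTop,
    δ (k + 1) ≤
      (k : ℝ) ^ p / ((1 + c) * (k : ℝ) ^ p - c * ((k : ℝ) + 1) ^ p) * δ k

end

/-! Multiplying the optimality condition of the proximal step by `1 / d_k = 1 + γ_k + h² a_k`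
removes the inertial parameter and gives `v_k - v_{k+1} = γ_k (x_{k+1} - x_k) + D_k ∇g(x_{k+1}) +
A_k x_{k+1}`. Here `v_k = x_k - x_{k-1} + b ∇g(x_k)`, `b = β h`, `γ_k ~ k^(-q)`, `A_k ~ k^(-p)` and
`D_k = h² δ_k`. This is a damped inertial system driven by the gradient of `D_k g + A_k ‖·‖² / 2`,
whose minimizer `z_k` is the Tikhonov point.

The energy `E_k` is the gap of that objective plus `‖(γ_k/2)(x_k - z_k) + v_k‖² / 2 + γ_k² ‖x_k -
z_k‖² / 8`. With parameters and target frozen, a step contracts it by a factor `1 + r`, up to a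
small source, provided `r ≲ γ_k` and `r γ_k ≲ A_k` (`lyapunov_step`). This permits `r ~ k^(-m)` with
`m = max(q, p - q)`. Parameters and Tikhonov points drift by relative amounts `O(1/k)`, negligible
against `r` since `m < 1`; updating them costs only a factor `1 + r/2` and further sources
(`lyapunov_change`).

The remaining sources are of order `k^(-2p)`, `k^(-1-p)` and `k^(m-2-2q)`. A discrete Gronwall
argument (`exists_eventually_le_mul_rpow_neg`) then gives `E_k = O(k^(-ω))` with `ω = min(1 + p - m,
2 + 2q - 2m)`; the regimes of the theorem record which terms attain the maximum and the minimum.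
Values and distances are read off from `E_k`, and the recursion solved for `∇g(x_{k+1})` gives
gradients and velocities. Strong convergence follows because `x_k - z_k → 0` and the Tikhonov path
converges to the minimum-norm solution (`tendsto_of_isTikhonovPoint`). -/

/-! ### Convex analysis: Tikhonov points and the minimum-norm solution. -/

section ConvexAnalysis

variable {X : Type*} [NormedAddCommGroup X] [InnerProductSpace ℝ X]

/-- The first-order (subgradient) inequality of a convex differentiable function. -/
theorem ConvexOn.add_inner_gradient_le [CompleteSpace X] {g : X → ℝ}
    (hg : ConvexOn ℝ Set.univ g) (hd : Differentiable ℝ g) (x y : X) :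
    g x + inner ℝ (gradient g x) (y - x) ≤ g y := by
  have hline : ConvexOn ℝ Set.univ (g ∘ (AffineMap.lineMap x y : ℝ →ᵃ[ℝ] X)) := by
    simpa using hg.comp_affineMap (AffineMap.lineMap x y : ℝ →ᵃ[ℝ] X)
  have hder : HasDerivAt (g ∘ (AffineMap.lineMap x y : ℝ →ᵃ[ℝ] X))
      (inner ℝ (gradient g x) (y - x)) 0 := by
    have h1 : HasFDerivAt g (fderiv ℝ g x) ((AffineMap.lineMap x y : ℝ →ᵃ[ℝ] X) 0) := by
      simpa using (hd x).hasFDerivAt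
    have h2 : HasDerivAt (AffineMap.lineMap x y : ℝ →ᵃ[ℝ] X) (y - x) (0 : ℝ) :=
      AffineMap.hasDerivAt_lineMap
    have h3 := h1.comp_hasDerivAt (0 : ℝ) h2
    rwa [← inner_gradient_left] at h3
  have := hline.le_slope_of_hasDerivAt (Set.mem_univ 0) (Set.mem_univ 1) zero_lt_one hder
  simp only [slope, sub_zero, inv_one, one_smul, Function.comp_apply, AffineMap.lineMap_apply_one,
    AffineMap.lineMap_apply_zero, vsub_eq_sub] at this
  linarith

theorem hasGradientAt_half_mul_norm_sub_sq [CompleteSpace X] (c : ℝ) (z u : X) :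
    HasGradientAt (fun w : X => c / 2 * ‖w - z‖ ^ 2) (c • (u - z)) u := by
  rw [hasGradientAt_iff_hasFDerivAt]
  have h := (((hasFDerivAt_id (𝕜 := ℝ) u).sub_const z).norm_sq).const_mul (c / 2)
  refine h.congr_fderiv ?_
  ext y
  simp
  ring

/-- Stationarity of a minimizer of a quadratic perturbation of a differentiable function. -/
theorem IsMinOn.gradient_add_smul_eq_zero [CompleteSpace X] {g : X → ℝ}
    (hd : Differentiable ℝ g) {c : ℝ} {z u : X}
    (h : IsMinOn (fun w => g w + c / 2 * ‖w - z‖ ^ 2) Set.univ u) :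
    gradient g u + c • (u - z) = 0 := by
  have h1 : HasFDerivAt (fun w => g w + c / 2 * ‖w - z‖ ^ 2) _ u :=
    (hd u).hasGradientAt.hasFDerivAt.add
      (hasGradientAt_half_mul_norm_sub_sq c z u).hasFDerivAt
  have h2 := (h.isLocalMin univ_mem).hasFDerivAt_eq_zero h1
  rw [← map_add] at h2
  exact (LinearIsometryEquiv.map_eq_zero_iff _).1 h2

theorem IsTikhonovPoint.gradient_eq [CompleteSpace X] {g : X → ℝ} (hd : Differentiable ℝ g)
    {ε : ℝ} {z : X} (h : IsTikhonovPoint g ε z) : gradient g z + ε • z = 0 := by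
  have h' : IsMinOn (fun w => g w + ε / 2 * ‖w - 0‖ ^ 2) Set.univ z := by
    simpa [IsTikhonovPoint] using h
  simpa using h'.gradient_add_smul_eq_zero hd

theorem IsProx.gradient_eq [CompleteSpace X] {g : X → ℝ} (hd : Differentiable ℝ g)
    {ρ : ℝ} {z u : X} (hρ : ρ ≠ 0) (h : IsProx ρ g z u) : u + ρ • gradient g u = z := by
  have h' : IsMinOn (fun w => g w + ρ⁻¹ / 2 * ‖w - z‖ ^ 2) Set.univ u := by
    have e : 1 / (2 * ρ) = ρ⁻¹ / 2 := by field_simp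
    rw [← e]
    exact h
  have h1 := congrArg (fun y => ρ • y) (h'.gradient_add_smul_eq_zero hd)
  simp only [smul_add, smul_smul, mul_inv_cancel₀ hρ, one_smul, smul_zero] at h1
  rw [← sub_eq_zero, ← h1]
  abel

theorem norm_sq_midpoint (x y : X) :
    ‖(2⁻¹ : ℝ) • x + (2⁻¹ : ℝ) • y‖ ^ 2 = (‖x‖ ^ 2 + ‖y‖ ^ 2) / 2 - ‖x - y‖ ^ 2 / 4 := by
  rw [← smul_add, norm_smul, norm_sub_sq_real, mul_pow, norm_add_sq_real]
  norm_num
  ring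

theorem convex_argminSet {g : X → ℝ} (hg : ConvexOn ℝ Set.univ g) : Convex ℝ (argminSet g) := by
  intro x hx y hy a b ha hb hab z _
  have h1 := hg.2 (Set.mem_univ x) (Set.mem_univ y) ha hb hab
  have h2 : g x ≤ g z := hx (Set.mem_univ z)
  have h3 : g y ≤ g z := hy (Set.mem_univ z)
  simp only [smul_eq_mul] at h1
  have : a * g x + b * g y ≤ g z := by
    calc a * g x + b * g y ≤ a * g z + b * g z := by gcongr
      _ = g z := by rw [← add_mul, hab, one_mul]
  exact h1.trans this

/-- The solution set is closed and convex, so 0 has a projection onto it; two distinct projections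
would have a midpoint of smaller norm. -/
theorem existsUnique_isMinNormSolution [CompleteSpace X] {g : X → ℝ}
    (hg : ConvexOn ℝ Set.univ g) (hc : Continuous g) (hs : (argminSet g).Nonempty) :
    ∃! z, IsMinNormSolution g z := by
  have hclosed : IsClosed (argminSet g) := by
    have : argminSet g = ⋂ y, {x | g x ≤ g y} := by
      ext x
      simp [argminSet, isMinOn_iff]
    rw [this]
    exact isClosed_iInter fun y => isClosed_le hc continuous_const
  obtain ⟨z, hz, hz'⟩ := exists_norm_eq_iInf_of_complete_convex hs hclosed.isComplete
    (convex_argminSet hg) 0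
  have hmin : IsMinNormSolution g z := by
    refine ⟨hz, fun y hy => ?_⟩
    simp only [zero_sub, norm_neg] at hz'
    rw [hz']
    exact ciInf_le (f := fun w : argminSet g => ‖(w : X)‖)
      ⟨0, by rintro _ ⟨w, rfl⟩; exact norm_nonneg _⟩ ⟨y, hy⟩
  refine ⟨z, hmin, fun y hy => ?_⟩
  have hn : ‖y‖ = ‖z‖ := le_antisymm (hy.2 z hz) (hmin.2 y hy.1)
  have hm := hmin.2 _ (convex_argminSet hg hy.1 hz (a := 2⁻¹) (b := 2⁻¹) (by norm_num)
    (by norm_num) (by norm_num))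
  have hp := pow_le_pow_left₀ (norm_nonneg _) hm 2
  rw [norm_sq_midpoint, hn] at hp
  have : ‖y - z‖ ^ 2 = 0 := le_antisymm (by linarith) (by positivity)
  exact sub_eq_zero.1 (norm_eq_zero.1 (pow_eq_zero_iff (two_ne_zero)|>.1 this))

/-- Quantitative midpoint convexity of a Tikhonov regularized convex function. -/
theorem ConvexOn.tikhonov_midpoint_le {g : X → ℝ} (hg : ConvexOn ℝ Set.univ g) (ε : ℝ) (x y : X) :
    g ((2⁻¹ : ℝ) • x + (2⁻¹ : ℝ) • y) + ε / 2 * ‖(2⁻¹ : ℝ) • x + (2⁻¹ : ℝ) • y‖ ^ 2 ≤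
      ((g x + ε / 2 * ‖x‖ ^ 2) + (g y + ε / 2 * ‖y‖ ^ 2)) / 2 - ε / 8 * ‖x - y‖ ^ 2 := by
  have h := hg.2 (Set.mem_univ x) (Set.mem_univ y) (by norm_num : (0 : ℝ) ≤ 2⁻¹)
    (by norm_num : (0 : ℝ) ≤ 2⁻¹) (by norm_num)
  simp only [smul_eq_mul] at h
  rw [norm_sq_midpoint]
  linarith

/-- Midpoint strong convexity bounds the squared distance of two points by their excess over the
infimum. Hence minimizing sequences are Cauchy and minimizers are unique. -/
theorem existsUnique_isTikhonovPoint [CompleteSpace X] {g : X → ℝ}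
    (hg : ConvexOn ℝ Set.univ g) (hc : Continuous g) (hs : (argminSet g).Nonempty)
    {ε : ℝ} (hε : 0 < ε) : ∃! z, IsTikhonovPoint g ε z := by
  set f : X → ℝ := fun x => g x + ε / 2 * ‖x‖ ^ 2 with hf
  have hfc : Continuous f := by fun_prop
  obtain ⟨s, hs⟩ := hs
  have hbdd : BddBelow (Set.range f) := by
    refine ⟨g s, ?_⟩
    rintro _ ⟨x, rfl⟩
    have h1 : g s ≤ g x := hs (Set.mem_univ x)
    have h2 : 0 ≤ ε / 2 * ‖x‖ ^ 2 := by positivity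
    simp only [hf]
    linarith
  have hmid : ∀ x y, ε / 8 * ‖x - y‖ ^ 2 ≤ (f x + f y) / 2 - ⨅ w, f w := by
    intro x y
    have h1 := hg.tikhonov_midpoint_le ε x y
    have h2 := ciInf_le hbdd ((2⁻¹ : ℝ) • x + (2⁻¹ : ℝ) • y)
    simp only [hf] at h2 ⊢
    linarith
  have hex : ∀ n : ℕ, ∃ x, f x < (⨅ w, f w) + 1 / ((n : ℝ) + 1) := fun n =>
    exists_lt_of_ciInf_lt (lt_add_of_pos_right _ (by positivity))
  choose u hu using hex
  have hcau : CauchySeq u := by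
    refine cauchySeq_of_le_tendsto_0 (fun n : ℕ => √(8 / ε * (1 / ((n : ℝ) + 1)))) ?_ ?_
    · intro n m N hn hm
      refine Real.le_sqrt_of_sq_le ?_
      have h1 : (1 : ℝ) / ((n : ℝ) + 1) ≤ 1 / ((N : ℝ) + 1) := by gcongr
      have h2 : (1 : ℝ) / ((m : ℝ) + 1) ≤ 1 / ((N : ℝ) + 1) := by gcongr
      have h3 := hmid (u n) (u m)
      have h4 := hu n
      have h5 := hu m
      rw [dist_eq_norm]
      have h6 : ε / 8 * ‖u n - u m‖ ^ 2 ≤ 1 / ((N : ℝ) + 1) := by linarith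
      calc ‖u n - u m‖ ^ 2 = 8 / ε * (ε / 8 * ‖u n - u m‖ ^ 2) := by field_simp
        _ ≤ _ := by gcongr
    · have h1 := (tendsto_one_div_add_atTop_nhds_zero_nat (𝕜 := ℝ)).const_mul (8 / ε)
      have h2 := (Real.continuous_sqrt.tendsto _).comp h1
      simpa [Function.comp_def] using h2
  obtain ⟨z, hz⟩ := cauchySeq_tendsto_of_complete hcau
  have hlim : f z ≤ ⨅ w, f w := by
    have h1 : Tendsto (fun n => f (u n)) atTop (𝓝 (f z)) := (hfc.tendsto z).comp hz
    have h2 : Tendsto (fun n : ℕ => (⨅ w, f w) + 1 / ((n : ℝ) + 1)) atTop (𝓝 ((⨅ w, f w) + 0)) :=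
      tendsto_const_nhds.add (tendsto_one_div_add_atTop_nhds_zero_nat (𝕜 := ℝ))
    simpa using le_of_tendsto_of_tendsto' h1 h2 fun n => (hu n).le
  have hzmin : IsTikhonovPoint g ε z := fun y _ => hlim.trans (ciInf_le hbdd y)
  refine ⟨z, hzmin, fun y hy => ?_⟩
  have h1 : f y ≤ ⨅ w, f w := le_ciInf fun w => hy (Set.mem_univ w)
  have h2 := hmid y z
  have h3 : ε / 8 * ‖y - z‖ ^ 2 ≤ 0 := by linarith
  have h4 : ‖y - z‖ ^ 2 ≤ 0 := by
    by_contra hcon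
    have : 0 < ε / 8 * ‖y - z‖ ^ 2 := mul_pos (by positivity) (not_le.1 hcon)
    linarith
  have : ‖y - z‖ ^ 2 = 0 := le_antisymm h4 (by positivity)
  exact sub_eq_zero.1 (norm_eq_zero.1 (pow_eq_zero_iff (two_ne_zero)|>.1 this))

theorem IsTikhonovPoint.norm_le {X : Type*} [NormedAddCommGroup X] {g : X → ℝ} {ε : ℝ}
    (hε : 0 < ε) {z s : X}
    (h : IsTikhonovPoint g ε z) (hs : s ∈ argminSet g) : ‖z‖ ≤ ‖s‖ := by
  have h1 : g z + ε / 2 * ‖z‖ ^ 2 ≤ g s + ε / 2 * ‖s‖ ^ 2 := h (Set.mem_univ s)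
  have h2 : g s ≤ g z := hs (Set.mem_univ z)
  have h3 : ε / 2 * ‖z‖ ^ 2 ≤ ε / 2 * ‖s‖ ^ 2 := by linarith
  exact le_of_sq_le_sq (le_of_mul_le_mul_left h3 (by positivity)) (norm_nonneg _)

/-- Monotonicity of the gradient along two Tikhonov points. -/
theorem IsTikhonovPoint.inner_sub_nonpos [CompleteSpace X] {g : X → ℝ}
    (hg : ConvexOn ℝ Set.univ g) (hd : Differentiable ℝ g) {ε ε' : ℝ} {z z' : X}
    (h : IsTikhonovPoint g ε z) (h' : IsTikhonovPoint g ε' z') :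
    inner ℝ (ε • z - ε' • z') (z - z') ≤ 0 := by
  have e : gradient g z = -(ε • z) := eq_neg_of_add_eq_zero_left (h.gradient_eq hd)
  have e' : gradient g z' = -(ε' • z') := eq_neg_of_add_eq_zero_left (h'.gradient_eq hd)
  have h1 := hg.add_inner_gradient_le hd z z'
  have h2 := hg.add_inner_gradient_le hd z' z
  rw [e] at h1
  rw [e'] at h2
  simp only [inner_neg_left, inner_sub_left, inner_sub_right] at *
  linarith

/-- Lipschitz-type dependence of Tikhonov points on the logarithm of the parameter. -/
theorem IsTikhonovPoint.mul_norm_sub_le [CompleteSpace X] {g : X → ℝ}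
    (hg : ConvexOn ℝ Set.univ g) (hd : Differentiable ℝ g) {ε ε' : ℝ} {z z' : X}
    (h : IsTikhonovPoint g ε z) (h' : IsTikhonovPoint g ε' z') :
    ε * ‖z - z'‖ ≤ |ε' - ε| * ‖z'‖ := by
  rcases eq_or_ne z z' with rfl | hne
  · simpa using by positivity
  have h1 := h.inner_sub_nonpos hg hd h'
  have e : ε • z - ε' • z' = ε • (z - z') - (ε' - ε) • z' := by module
  rw [e, inner_sub_left, real_inner_smul_left, real_inner_smul_left,
    real_inner_self_eq_norm_sq] at h1
  have h2 : (ε' - ε) * inner ℝ z' (z - z') ≤ |ε' - ε| * (‖z'‖ * ‖z - z'‖) := by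
    calc (ε' - ε) * inner ℝ z' (z - z') ≤ |(ε' - ε) * inner ℝ z' (z - z')| := le_abs_self _
      _ = |ε' - ε| * |inner ℝ z' (z - z')| := abs_mul _ _
      _ ≤ _ := by gcongr; exact abs_real_inner_le_norm _ _
  have hpos : 0 < ‖z - z'‖ := norm_pos_iff.2 (sub_ne_zero.2 hne)
  refine le_of_mul_le_mul_right ?_ hpos
  nlinarith

/-- Gradient monotonicity splits as `(ε - ε') ⟪z, z - z'⟫ + ε' ‖z - z'‖² ≤ 0`. For `ε' < ε` this
forces `⟪z, z - z'⟫ ≤ 0`, and expanding `‖z - z'‖²` gives the bound. -/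
theorem IsTikhonovPoint.norm_sub_sq_le [CompleteSpace X] {g : X → ℝ}
    (hg : ConvexOn ℝ Set.univ g) (hd : Differentiable ℝ g) {ε ε' : ℝ} (hε' : 0 < ε')
    (hle : ε' ≤ ε) {z z' : X} (h : IsTikhonovPoint g ε z) (h' : IsTikhonovPoint g ε' z') :
    ‖z - z'‖ ^ 2 ≤ ‖z'‖ ^ 2 - ‖z‖ ^ 2 := by
  have h1 := h.inner_sub_nonpos hg hd h'
  rcases hle.eq_or_lt with rfl | hlt
  · have e : ε' • z - ε' • z' = ε' • (z - z') := by module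
    rw [e, real_inner_smul_left, real_inner_self_eq_norm_sq] at h1
    have h2 : ‖z - z'‖ ^ 2 = 0 := by
      refine le_antisymm (le_of_mul_le_mul_left (by simpa using h1) hε') (by positivity)
    have h3 : z = z' := sub_eq_zero.1 (norm_eq_zero.1 (pow_eq_zero_iff (two_ne_zero)|>.1 h2))
    subst h3
    simp
  · have e : ε • z - ε' • z' = (ε - ε') • z + ε' • (z - z') := by module
    rw [e, inner_add_left, real_inner_smul_left, real_inner_smul_left,
      real_inner_self_eq_norm_sq] at h1
    have h2 : inner ℝ z (z - z') ≤ 0 := by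
      have h3 : 0 ≤ ε' * ‖z - z'‖ ^ 2 := by positivity
      refine le_of_mul_le_mul_left (?_ : (ε - ε') * _ ≤ (ε - ε') * 0) (sub_pos.2 hlt)
      linarith
    rw [inner_sub_right, real_inner_self_eq_norm_sq] at h2
    rw [norm_sub_sq_real]
    linarith

/-- Strong convergence of the Tikhonov path to the minimum-norm solution. -/
theorem tendsto_of_isTikhonovPoint [CompleteSpace X] {g : X → ℝ}
    (hg : ConvexOn ℝ Set.univ g) (hd : Differentiable ℝ g) {ε : ℕ → ℝ} {z : ℕ → X} {s : X}
    (hs : IsMinNormSolution g s) (hε : ∀ k, 0 < ε k) (hanti : Antitone ε)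
    (hlim : Tendsto ε atTop (𝓝 0)) (hz : ∀ k, IsTikhonovPoint g (ε k) (z k)) :
    Tendsto z atTop (𝓝 s) := by
  have hle : ∀ k, ‖z k‖ ≤ ‖s‖ := fun k => (hz k).norm_le (hε k) hs.1
  -- Squared distances are controlled by increments of the bounded monotone sequence `‖z k‖²`, so
  -- the path is Cauchy. Its limit minimizes `g` and has norm at most `‖s‖`, hence equals `s`.
  have hsq : ∀ m n, m ≤ n → ‖z m - z n‖ ^ 2 ≤ ‖z n‖ ^ 2 - ‖z m‖ ^ 2 := fun m n hmn =>
    (hz m).norm_sub_sq_le hg hd (hε n) (hanti hmn) (hz n)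
  have hmono : Monotone fun k => ‖z k‖ ^ 2 := fun m n hmn => by
    have := hsq m n hmn
    have h2 : 0 ≤ ‖z m - z n‖ ^ 2 := by positivity
    simp only
    linarith
  have hbdd : BddAbove (Set.range fun k => ‖z k‖ ^ 2) := by
    refine ⟨‖s‖ ^ 2, ?_⟩
    rintro _ ⟨k, rfl⟩
    exact pow_le_pow_left₀ (norm_nonneg _) (hle k) 2
  have hconv := tendsto_atTop_ciSup hmono hbdd
  have hcau : CauchySeq z := by
    refine cauchySeq_of_le_tendsto_0
      (fun n => 2 * √((⨆ k, ‖z k‖ ^ 2) - ‖z n‖ ^ 2)) ?_ ?_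
    · have key : ∀ N n, N ≤ n → ‖z N - z n‖ ≤ √((⨆ k, ‖z k‖ ^ 2) - ‖z N‖ ^ 2) := by
        intro N n hn
        refine Real.le_sqrt_of_sq_le ((hsq N n hn).trans ?_)
        have := le_ciSup hbdd n
        linarith
      intro n m N hn hm
      have h1 := dist_triangle_left (z n) (z m) (z N)
      rw [dist_eq_norm (z N), dist_eq_norm (z N)] at h1
      have := key N n hn
      have := key N m hm
      linarith
    · have h1 := (tendsto_const_nhds (x := ⨆ k, ‖z k‖ ^ 2)).sub hconv
      have h2 := ((Real.continuous_sqrt.tendsto _).comp h1).const_mul 2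
      simpa using h2
  obtain ⟨l, hl⟩ := cauchySeq_tendsto_of_complete hcau
  have hgl : g l ≤ g s := by
    have h1 : Tendsto (fun n => g (z n)) atTop (𝓝 (g l)) := (hd.continuous.tendsto l).comp hl
    have h2 : Tendsto (fun n => g s + ε n / 2 * ‖s‖ ^ 2) atTop
        (𝓝 (g s + 0 / 2 * ‖s‖ ^ 2)) :=
      tendsto_const_nhds.add ((hlim.div_const 2).mul_const _)
    have h3 := le_of_tendsto_of_tendsto' h1 h2 fun n => by
      have h4 : g (z n) + ε n / 2 * ‖z n‖ ^ 2 ≤ g s + ε n / 2 * ‖s‖ ^ 2 := hz n (Set.mem_univ s)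
      have h5 : 0 ≤ ε n / 2 * ‖z n‖ ^ 2 := by have := hε n; positivity
      linarith
    simpa using h3
  have hlmin : l ∈ argminSet g := fun y _ => hgl.trans (hs.1 (Set.mem_univ y))
  have hlnorm : ‖l‖ ≤ ‖s‖ := le_of_tendsto' hl.norm hle
  have hl' : IsMinNormSolution g l := ⟨hlmin, fun y hy => hlnorm.trans (hs.2 y hy)⟩
  have hls : l = s :=
    (existsUnique_isMinNormSolution hg hd.continuous ⟨s, hs.1⟩).unique hl' hs
  rwa [← hls]

end ConvexAnalysis

/-! ### One-step estimates for the Lyapunov function. -/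

section EnergyStep

variable {X : Type*} [NormedAddCommGroup X] [InnerProductSpace ℝ X]

/-- The Lyapunov function: `e` is the gap of the regularized objective, `γ` the damping,
`y` the deviation from the regularized minimizer and `v` the modified velocity. -/
noncomputable def lyapunov (e γ : ℝ) (y v : X) : ℝ :=
  e + 1 / 2 * ‖(γ / 2) • y + v‖ ^ 2 + γ ^ 2 / 8 * ‖y‖ ^ 2

/-- Decrease of the Lyapunov function along one step with frozen parameters; `w` is the increment
and `G` the gradient at the new point `s = y + z`. -/
theorem lyapunov_step_aux {γ b D A e e' : ℝ} {w y s v v' G : X} (hγ : 0 < γ)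
    (hv' : v' = w + b • G) (hv : v = v' + γ • w + (D • G + A • s))
    (he : e' - e ≤ inner ℝ (D • G + A • s) w)
    (he' : e' + A / 2 * ‖y‖ ^ 2 ≤ inner ℝ (D • G + A • s) y) :
    lyapunov e' γ y v' ≤ lyapunov e γ (y - w) v - γ / 2 * ‖w‖ ^ 2 - γ / 2 * b * inner ℝ G w
      - γ / 2 * (e' + A / 2 * ‖y‖ ^ 2) - b * D * ‖G‖ ^ 2 - b * A * inner ℝ G s := by
  set P := D • G + A • s with hP
  have hu : (γ / 2) • (y - w) + v = ((γ / 2) • y + v') + ((γ / 2) • w + P) := by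
    rw [hv]; module
  have h1 : ‖(γ / 2) • (y - w) + v‖ ^ 2 = ‖(γ / 2) • y + v'‖ ^ 2
      + 2 * inner ℝ ((γ / 2) • y + v') ((γ / 2) • w + P) + ‖(γ / 2) • w + P‖ ^ 2 := by
    rw [hu, norm_add_sq_real]
  have h2 : 0 ≤ ‖(γ / 2) • w + P‖ ^ 2 := by positivity
  -- The term `γ² / 4 * ⟪y, w⟫` cancels against the one in `γ² / 8 * ‖y - w‖²`, which fixes the
  -- weight `γ² / 8`; `⟪P, w⟫` absorbs the change of the gap.
  have h3 : inner ℝ ((γ / 2) • y + v') ((γ / 2) • w + P) =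
      γ ^ 2 / 4 * inner ℝ y w + γ / 2 * ‖w‖ ^ 2 + γ / 2 * b * inner ℝ G w
      + γ / 2 * inner ℝ P y + inner ℝ P w + (b * D * ‖G‖ ^ 2 + b * A * inner ℝ G s) := by
    have h4 : inner ℝ P G = D * ‖G‖ ^ 2 + A * inner ℝ G s := by
      rw [hP, inner_add_left, real_inner_smul_left, real_inner_smul_left,
        real_inner_self_eq_norm_sq, real_inner_comm]
    rw [hv']
    simp only [inner_add_left, inner_add_right, real_inner_smul_left, real_inner_smul_right,
      real_inner_self_eq_norm_sq, real_inner_comm P, h4]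
    ring
  have h5 : ‖y - w‖ ^ 2 = ‖y‖ ^ 2 - 2 * inner ℝ y w + ‖w‖ ^ 2 := norm_sub_sq_real y w
  have h6 : γ / 2 * (e' + A / 2 * ‖y‖ ^ 2) ≤ γ / 2 * inner ℝ P y := by gcongr
  have h7 : 0 ≤ γ ^ 2 / 8 * ‖w‖ ^ 2 := by positivity
  unfold lyapunov
  rw [h1, h3, h5]
  linarith

/-- Contraction of the Lyapunov function along one step with frozen parameters. -/
theorem lyapunov_step {γ b D A e e' r : ℝ} {w y z v v' G : X} (hγ : 0 < γ) (hb : 0 < b)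
    (hD : 0 < D) (hA : 0 < A) (hr : 0 < r)
    (h1 : 6 * r ≤ γ) (h2 : 4 * r * γ ≤ A) (h3 : 3 * r * b ≤ D) (h4 : γ * b ≤ D)
    (h5 : 16 * b * A ≤ γ * D)
    (hv' : v' = w + b • G) (hv : v = v' + γ • w + (D • G + A • (y + z)))
    (he : e' - e ≤ inner ℝ (D • G + A • (y + z)) w)
    (he' : e' + A / 2 * ‖y‖ ^ 2 ≤ inner ℝ (D • G + A • (y + z)) y)
    (he0 : 0 ≤ e') :
    (1 + r) * lyapunov e' γ y v' ≤ lyapunov e γ (y - w) v + 2 * b * A ^ 2 / D * ‖z‖ ^ 2 := by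
  have haux := lyapunov_step_aux hγ hv' hv he he'
  have hw : -(γ / 2 * b * inner ℝ G w) ≤ γ / 4 * ‖w‖ ^ 2 + b * D / 4 * ‖G‖ ^ 2 := by
    have i1 : 0 ≤ γ / 4 * ‖w + b • G‖ ^ 2 := by positivity
    rw [norm_add_sq_real, norm_smul, real_inner_smul_right, real_inner_comm, Real.norm_eq_abs,
      mul_pow, sq_abs] at i1
    have i2 : b / 4 * ‖G‖ ^ 2 * (γ * b) ≤ b / 4 * ‖G‖ ^ 2 * D := by gcongr
    linarith
  have hs : -(b * A * inner ℝ G (y + z)) ≤ b * D / 4 * ‖G‖ ^ 2 + b * A ^ 2 / D * ‖y + z‖ ^ 2 := by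
    have i1 : 0 ≤ b / D * ‖(D / 2) • G + A • (y + z)‖ ^ 2 := by positivity
    rw [norm_add_sq_real, norm_smul, norm_smul, real_inner_smul_left, real_inner_smul_right,
      Real.norm_eq_abs, mul_pow, sq_abs, Real.norm_eq_abs, mul_pow, sq_abs] at i1
    have i2 : b / D * ((D / 2) ^ 2 * ‖G‖ ^ 2 + 2 * (D / 2 * (A * inner ℝ G (y + z)))
        + A ^ 2 * ‖y + z‖ ^ 2) = b * D / 4 * ‖G‖ ^ 2 + b * A * inner ℝ G (y + z)
        + b * A ^ 2 / D * ‖y + z‖ ^ 2 := by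
      field_simp
      ring
    linarith
  have hyz : b * A ^ 2 / D * ‖y + z‖ ^ 2 ≤
      γ * A / 8 * ‖y‖ ^ 2 + 2 * b * A ^ 2 / D * ‖z‖ ^ 2 := by
    have i1 : ‖y + z‖ ^ 2 ≤ 2 * ‖y‖ ^ 2 + 2 * ‖z‖ ^ 2 := by
      have := parallelogram_law_with_norm ℝ y z
      nlinarith [sq_nonneg ‖y - z‖]
    have i2 : 2 * (b * A ^ 2 / D) ≤ γ * A / 8 := by
      rw [← mul_div_assoc, div_le_iff₀ hD]
      nlinarith
    calc b * A ^ 2 / D * ‖y + z‖ ^ 2 ≤ b * A ^ 2 / D * (2 * ‖y‖ ^ 2 + 2 * ‖z‖ ^ 2) := by gcongr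
      _ = 2 * (b * A ^ 2 / D) * ‖y‖ ^ 2 + 2 * b * A ^ 2 / D * ‖z‖ ^ 2 := by ring
      _ ≤ _ := by gcongr
  have hF : lyapunov e' γ y v' ≤ e' + γ ^ 2 / 2 * ‖y‖ ^ 2 + 3 / 2 * ‖w‖ ^ 2
      + 3 / 2 * b ^ 2 * ‖G‖ ^ 2 := by
    have i1 : ‖(γ / 2) • y + v'‖ ≤ γ / 2 * ‖y‖ + ‖w‖ + b * ‖G‖ := by
      rw [hv', ← add_assoc]
      refine (norm_add₃_le).trans_eq ?_
      rw [norm_smul, norm_smul, Real.norm_of_nonneg hb.le, Real.norm_of_nonneg (by positivity)]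
    have i2 : ‖(γ / 2) • y + v'‖ ^ 2 ≤
        3 * (γ / 2 * ‖y‖) ^ 2 + 3 * ‖w‖ ^ 2 + 3 * (b * ‖G‖) ^ 2 := by
      refine (pow_le_pow_left₀ (norm_nonneg _) i1 2).trans ?_
      nlinarith [sq_nonneg (γ / 2 * ‖y‖ - ‖w‖), sq_nonneg (γ / 2 * ‖y‖ - b * ‖G‖),
        sq_nonneg (‖w‖ - b * ‖G‖)]
    unfold lyapunov
    nlinarith
  -- After the Young inequalities the dissipation still contains `γ/2 * e'`, `γ A/8 * ‖y‖²`, `γ/4 *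
  -- ‖w‖²` and `b D/2 * ‖G‖²`. Each dominates `r` times the matching term of `hF`, which is how the
  -- constants in `h1`, `h2`, `h3` arise.
  have hrF := mul_le_mul_of_nonneg_left hF hr.le
  have j1 : r * e' ≤ γ / 2 * e' := by gcongr; linarith
  have j2 : r * (γ ^ 2 / 2 * ‖y‖ ^ 2) ≤ γ * A / 8 * ‖y‖ ^ 2 := by
    have := mul_le_mul_of_nonneg_right h2 (by positivity : 0 ≤ γ / 8 * ‖y‖ ^ 2)
    linarith
  have j3 : r * (3 / 2 * ‖w‖ ^ 2) ≤ γ / 4 * ‖w‖ ^ 2 := by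
    have := mul_le_mul_of_nonneg_right h1 (by positivity : 0 ≤ ‖w‖ ^ 2)
    linarith
  have j4 : r * (3 / 2 * b ^ 2 * ‖G‖ ^ 2) ≤ b * D / 2 * ‖G‖ ^ 2 := by
    have := mul_le_mul_of_nonneg_right h3 (by positivity : 0 ≤ b / 2 * ‖G‖ ^ 2)
    linarith
  linarith

/-- Effect of the change of parameters on the Lyapunov function. -/
theorem lyapunov_change {γ γ' e e' r κ s : ℝ} {x z z' v : X} (hγ : 0 < γ') (he : 0 ≤ e)
    (hr : 0 < r) (hr4 : r ≤ 4) (hκ : 0 ≤ κ) (hκr : 8 * κ ≤ r)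
    (hγle : γ' ≤ γ) (hγκ : γ - γ' ≤ κ * γ) (hz : ‖z - z'‖ ≤ κ) (hee : e' ≤ (1 + κ) * e + s) :
    lyapunov e' γ' (x - z') v ≤
      (1 + r / 2) * lyapunov e γ (x - z) v + s + 4 * γ ^ 2 * κ ^ 2 / r := by
  -- Young's inequality with weight `r / 4`; the coefficient `1 + 4 / r` is rounded up to `8 / r`
  -- using `r ≤ 4`.
  have young : ∀ a c : X, ‖a + c‖ ^ 2 ≤ (1 + r / 4) * ‖a‖ ^ 2 + 8 / r * ‖c‖ ^ 2 := by
    intro a c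
    have i1 : 0 ≤ 1 / r * ‖(r / 2) • a - (2 : ℝ) • c‖ ^ 2 := by positivity
    rw [norm_sub_sq_real, norm_smul, norm_smul, real_inner_smul_left, real_inner_smul_right,
      Real.norm_eq_abs, mul_pow, sq_abs, Real.norm_eq_abs, mul_pow, sq_abs] at i1
    have i2 : 1 / r * ((r / 2) ^ 2 * ‖a‖ ^ 2 - 2 * (r / 2 * (2 * inner ℝ a c))
        + 2 ^ 2 * ‖c‖ ^ 2) = r / 4 * ‖a‖ ^ 2 - 2 * inner ℝ a c + 4 / r * ‖c‖ ^ 2 := by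
      field_simp
      ring
    have i3 : 1 ≤ 4 / r := by rw [le_div_iff₀ hr]; linarith
    have i4 : 1 * ‖c‖ ^ 2 ≤ 4 / r * ‖c‖ ^ 2 := by gcongr
    have i5 : 8 / r * ‖c‖ ^ 2 = 4 / r * ‖c‖ ^ 2 + 4 / r * ‖c‖ ^ 2 := by ring
    rw [norm_add_sq_real]
    linarith
  have hκz : ‖z - z'‖ ^ 2 ≤ κ ^ 2 := pow_le_pow_left₀ (norm_nonneg _) hz 2
  have hγ0 : 0 < γ := hγ.trans_le hγle
  have hγ2 : γ' ^ 2 ≤ γ ^ 2 := pow_le_pow_left₀ hγ.le hγle 2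
  have hy : γ' ^ 2 / 8 * ‖x - z'‖ ^ 2 ≤
      (1 + r / 4) * (γ ^ 2 / 8 * ‖x - z‖ ^ 2) + γ ^ 2 * κ ^ 2 / r := by
    have i1 := young (x - z) (z - z')
    rw [sub_add_sub_cancel] at i1
    calc γ' ^ 2 / 8 * ‖x - z'‖ ^ 2
        ≤ γ ^ 2 / 8 * ((1 + r / 4) * ‖x - z‖ ^ 2 + 8 / r * κ ^ 2) := by
          gcongr
          exact i1.trans (by gcongr)
      _ = _ := by ring
  have hu : 1 / 2 * ‖(γ' / 2) • (x - z') + v‖ ^ 2 ≤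
      (1 + r / 4) * (1 / 2 * ‖(γ / 2) • (x - z) + v‖ ^ 2)
        + (r / 4 * (γ ^ 2 / 8 * ‖x - z‖ ^ 2) + 2 * γ ^ 2 * κ ^ 2 / r) := by
    -- The perturbation separates the change of damping from the displacement of the target. Since
    -- `8 κ ≤ r`, the former is charged to `γ² / 8 * ‖x - z‖²`; the latter leaves a source `γ² κ² /
    -- r`.
    set c : X := ((γ' - γ) / 2) • (x - z) + (γ' / 2) • (z - z') with hc
    have i1 := young ((γ / 2) • (x - z) + v) c
    have i2 : (γ / 2) • (x - z) + v + c = (γ' / 2) • (x - z') + v := by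
      rw [hc]; module
    rw [i2] at i1
    have i3 : ‖c‖ ≤ γ * κ / 2 * ‖x - z‖ + γ * κ / 2 := by
      refine (norm_add_le _ _).trans ?_
      rw [norm_smul, norm_smul, Real.norm_eq_abs, Real.norm_of_nonneg (by positivity),
        abs_of_nonpos (by linarith)]
      have : γ' / 2 * ‖z - z'‖ ≤ γ / 2 * κ := by gcongr
      have : -((γ' - γ) / 2) * ‖x - z‖ ≤ γ * κ / 2 * ‖x - z‖ := by gcongr; linarith
      linarith
    have i4 : ‖c‖ ^ 2 ≤ γ ^ 2 * κ ^ 2 / 2 * ‖x - z‖ ^ 2 + γ ^ 2 * κ ^ 2 / 2 := by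
      refine (pow_le_pow_left₀ (norm_nonneg _) i3 2).trans ?_
      nlinarith [sq_nonneg (γ * κ / 2 * ‖x - z‖ - γ * κ / 2)]
    have i5 : 4 / r * (γ ^ 2 * κ ^ 2 / 2 * ‖x - z‖ ^ 2) ≤ r / 4 * (γ ^ 2 / 8 * ‖x - z‖ ^ 2) := by
      have k1 : 64 * κ ^ 2 ≤ r ^ 2 := by nlinarith
      have k2 : 4 / r * κ ^ 2 / 2 ≤ r / 4 / 8 := by
        rw [div_mul_eq_mul_div, div_div, div_div, div_le_div_iff₀ (by positivity) (by norm_num)]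
        nlinarith
      have := mul_le_mul_of_nonneg_right k2 (by positivity : 0 ≤ γ ^ 2 * ‖x - z‖ ^ 2)
      linarith
    have i6 : 4 / r * ‖c‖ ^ 2 ≤ 4 / r * (γ ^ 2 * κ ^ 2 / 2 * ‖x - z‖ ^ 2 + γ ^ 2 * κ ^ 2 / 2) := by
      gcongr
    have i7 : 4 / r * (γ ^ 2 * κ ^ 2 / 2) = 2 * γ ^ 2 * κ ^ 2 / r := by ring
    have i8 : 8 / r * ‖c‖ ^ 2 = 2 * (4 / r * ‖c‖ ^ 2) := by ring
    linarith
  have h1 : κ * e ≤ r / 2 * e := by gcongr; linarith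
  have h2 : 0 ≤ γ ^ 2 * κ ^ 2 / r := by positivity
  have h3 : 0 ≤ r / 4 * (1 / 2 * ‖(γ / 2) • (x - z) + v‖ ^ 2) := by positivity
  have h4 : 4 * γ ^ 2 * κ ^ 2 / r = 4 * (γ ^ 2 * κ ^ 2 / r) := by ring
  have h5 : 2 * γ ^ 2 * κ ^ 2 / r = 2 * (γ ^ 2 * κ ^ 2 / r) := by ring
  unfold lyapunov
  rw [h4]
  rw [h5] at hu
  linarith

end EnergyStep

/-! ### Power sequences: relative increments and a discrete Gronwall estimate. -/

section PowerSequences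

/-- A Bernoulli-type bound from `log (1 + t) ≤ t` and `exp u ≥ 1 + u`: over one step `k^(-a)` loses
at most the fraction `a / k`. -/
theorem one_sub_div_mul_rpow_le {a : ℝ} (ha : 0 ≤ a) {k : ℕ} (hk : 1 ≤ k) :
    (1 - a / k) * (k : ℝ) ^ (-a) ≤ ((k : ℝ) + 1) ^ (-a) := by
  have hk0 : (0 : ℝ) < k := by exact_mod_cast hk
  have h1 : ((k : ℝ) + 1) = k * (1 + 1 / k) := by field_simp
  have h2 : 0 < 1 + 1 / (k : ℝ) := by positivity
  rw [h1, Real.mul_rpow hk0.le h2.le, mul_comm]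
  gcongr
  rw [Real.rpow_def_of_pos h2]
  have h3 : Real.log (1 + 1 / k) ≤ 1 / k := by linarith [Real.log_le_sub_one_of_pos h2]
  have h4 : a * Real.log (1 + 1 / k) ≤ a * (1 / k) := by gcongr
  have h5 := Real.add_one_le_exp (Real.log (1 + 1 / (k : ℝ)) * -a)
  have h6 : a / k = a * (1 / k) := by ring
  linarith

theorem rpow_neg_le_mul_succ_rpow_neg {a : ℝ} (ha : 0 ≤ a) {k : ℕ} (hk : 1 ≤ k) :
    (k : ℝ) ^ (-a) ≤ 2 ^ a * ((k + 1 : ℕ) : ℝ) ^ (-a) := by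
  have hk0 : (1 : ℝ) ≤ k := by exact_mod_cast hk
  have h1 : (2 * (k : ℝ)) ^ (-a) ≤ ((k + 1 : ℕ) : ℝ) ^ (-a) := by
    refine Real.rpow_le_rpow_of_nonpos (by positivity) ?_ (by linarith)
    push_cast
    linarith
  calc (k : ℝ) ^ (-a) = 2 ^ a * (2 * (k : ℝ)) ^ (-a) := by
        rw [Real.mul_rpow (by norm_num) (by linarith), ← mul_assoc, ← Real.rpow_add (by norm_num)]
        simp
    _ ≤ _ := by gcongr

/-- This is why drifts of order `1 / k` are harmless: a contraction rate `k^(-m)` with `m < 1`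
eventually exceeds them. -/
theorem eventually_div_le_mul_rpow_neg (K : ℝ) {c m : ℝ} (hc : 0 < c) (hm : m < 1) :
    ∀ᶠ k : ℕ in atTop, K / k ≤ c * (k : ℝ) ^ (-m) := by
  have h1 : Tendsto (fun k : ℕ => (k : ℝ) ^ (1 - m)) atTop atTop :=
    (tendsto_rpow_atTop (by linarith)).comp tendsto_natCast_atTop_atTop
  filter_upwards [h1.eventually_ge_atTop (K / c), eventually_ge_atTop 1] with k hk hk1
  have hk0 : (0 : ℝ) < k := by exact_mod_cast hk1
  rw [div_le_iff₀ hc] at hk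
  rw [div_le_iff₀ hk0, mul_assoc, ← Real.rpow_add_one hk0.ne', neg_add_eq_sub, mul_comm]
  exact hk

theorem rpow_natCast_le_rpow {a b : ℝ} (hab : a ≤ b) {k : ℕ} (hk : 1 ≤ k) :
    (k : ℝ) ^ a ≤ (k : ℝ) ^ b :=
  Real.rpow_le_rpow_of_exponent_le (by exact_mod_cast hk) hab

/-- A discrete Gronwall-type estimate with polynomially decaying contraction rate. -/
theorem exists_eventually_le_mul_rpow_neg {F : ℕ → ℝ} {c C m ω : ℝ} (hc : 0 < c)
    (hm0 : 0 < m) (hm : m < 1) (hω : 0 ≤ ω)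
    (hF : ∀ᶠ k : ℕ in atTop,
      F (k + 1) ≤ (1 - c * (k : ℝ) ^ (-m)) * F k + C * (k : ℝ) ^ (-m - ω)) :
    ∃ M, 0 ≤ M ∧ ∀ᶠ k : ℕ in atTop, F k ≤ M * (k : ℝ) ^ (-ω) := by
  have hsmall : ∀ᶠ k : ℕ in atTop, c * (k : ℝ) ^ (-m) ≤ 1 := by
    have h1 : Tendsto (fun k : ℕ => c * (k : ℝ) ^ (-m)) atTop (𝓝 (c * 0)) :=
      ((tendsto_rpow_neg_atTop hm0).comp tendsto_natCast_atTop_atTop).const_mul c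
    rw [mul_zero] at h1
    exact h1.eventually_le_const one_pos
  obtain ⟨N, hN⟩ := eventually_atTop.1
    (hF.and (hsmall.and ((eventually_div_le_mul_rpow_neg ω (half_pos hc) hm).and
      (eventually_ge_atTop 1))))
  -- The quotient at `N` starts the induction. In the inductive step half of the contraction absorbs
  -- the source, since `M ≥ 2 C / c`, and the other half absorbs the loss `ω / k` in passing from
  -- `k^(-ω)` to `(k+1)^(-ω)`.
  set M := max (max 0 (2 * C / c)) (F N / (N : ℝ) ^ (-ω)) with hM
  have hM0 : 0 ≤ M := (le_max_left _ _).trans (le_max_left _ _)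
  have hMC : 2 * C / c ≤ M := (le_max_right _ _).trans (le_max_left _ _)
  refine ⟨M, hM0, eventually_atTop.2 ⟨N, fun k hk => ?_⟩⟩
  induction k, hk using Nat.le_induction with
  | base =>
    have hN0 : (0 : ℝ) < N := by exact_mod_cast (hN N le_rfl).2.2.2
    rw [← div_le_iff₀ (by positivity)]
    exact le_max_right _ _
  | succ k hk ih =>
    obtain ⟨h1, h2, h3, h4⟩ := hN k hk
    have hk0 : (0 : ℝ) < k := by exact_mod_cast h4
    have h5 := one_sub_div_mul_rpow_le hω h4
    have h6 : (1 - c * (k : ℝ) ^ (-m)) * F k ≤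
        (1 - c * (k : ℝ) ^ (-m)) * (M * (k : ℝ) ^ (-ω)) := by
      gcongr
    have h7 : (k : ℝ) ^ (-m - ω) = (k : ℝ) ^ (-m) * (k : ℝ) ^ (-ω) := by
      rw [← Real.rpow_add hk0]; ring_nf
    have h8 : C ≤ M * (c / 2) := by
      rw [div_le_iff₀ hc] at hMC
      linarith
    have h9 : C * ((k : ℝ) ^ (-m) * (k : ℝ) ^ (-ω)) ≤
        M * (c / 2) * ((k : ℝ) ^ (-m) * (k : ℝ) ^ (-ω)) := by gcongr
    have h10 : M * (k : ℝ) ^ (-ω) * (ω / k) ≤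
        M * (k : ℝ) ^ (-ω) * (c / 2 * (k : ℝ) ^ (-m)) := by gcongr
    have h11 := mul_le_mul_of_nonneg_left h5 hM0
    rw [h7] at h1
    push_cast
    linarith

/-- With `t = p / k` small, `(k+1)^p ≤ (1 + 2t) k^p`, so the quotient is at most `1 / (1 - 2ct) ≤ 1
+ 4ct`; hence the constant `4 p c`. -/
theorem GrowthCondition.exists_le {p : ℝ} (hp : 0 ≤ p) {δ : ℕ → ℝ} (hδ : ∀ k, 1 ≤ k → 0 < δ k)
    (h : GrowthCondition p δ) :
    ∃ C, 0 ≤ C ∧ ∀ᶠ k : ℕ in atTop, δ (k + 1) ≤ (1 + C / k) * δ k := by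
  obtain ⟨c, hc, h⟩ := h
  refine ⟨4 * p * c, by positivity, ?_⟩
  have hlim : ∀ K : ℝ, ∀ᶠ k : ℕ in atTop, K / k ≤ 1 / 2 := fun K =>
    (tendsto_const_div_atTop_nhds_zero_nat K).eventually_le_const (by norm_num)
  filter_upwards [h, hlim p, hlim (2 * p * c), eventually_ge_atTop 1] with k h1 h2 h3 hk
  have hk0 : (0 : ℝ) < k := by exact_mod_cast hk
  have h4 := one_sub_div_mul_rpow_le hp hk
  have hkp : 0 < (k : ℝ) ^ p := by positivity
  have hkp' : 0 < ((k : ℝ) + 1) ^ p := by positivity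
  rw [Real.rpow_neg hk0.le, Real.rpow_neg (by positivity), ← div_eq_mul_inv,
    div_le_iff₀ hkp, ← div_eq_inv_mul, le_div_iff₀ hkp'] at h4
  set t := p / (k : ℝ) with ht
  have ht0 : 0 ≤ t := by positivity
  have e1 : 2 * p * c / k = 2 * c * t := by rw [ht]; ring
  have e2 : 4 * p * c / k = 4 * c * t := by rw [ht]; ring
  rw [e1] at h3
  rw [e2]
  have h5 : ((k : ℝ) + 1) ^ p ≤ (1 + 2 * t) * (k : ℝ) ^ p := by
    have i1 : 1 ≤ (1 + 2 * t) * (1 - t) := by nlinarith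
    calc ((k : ℝ) + 1) ^ p = 1 * ((k : ℝ) + 1) ^ p := (one_mul _).symm
      _ ≤ (1 + 2 * t) * (1 - t) * ((k : ℝ) + 1) ^ p := by gcongr
      _ = (1 + 2 * t) * ((1 - t) * ((k : ℝ) + 1) ^ p) := by ring
      _ ≤ _ := by gcongr
  have h6 : (1 - 2 * c * t) * (k : ℝ) ^ p ≤ (1 + c) * (k : ℝ) ^ p - c * ((k : ℝ) + 1) ^ p := by
    have := mul_le_mul_of_nonneg_left h5 hc.le
    linarith
  have h7 : 0 < 1 - 2 * c * t := by linarith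
  refine h1.trans (mul_le_mul_of_nonneg_right ?_ (hδ k hk).le)
  rw [div_le_iff₀ ((by positivity : 0 < (1 - 2 * c * t) * (k : ℝ) ^ p).trans_le h6)]
  have i1 : 1 ≤ (1 + 4 * c * t) * (1 - 2 * c * t) := by
    have : 0 ≤ c * t := by positivity
    nlinarith
  calc (k : ℝ) ^ p = 1 * (k : ℝ) ^ p := (one_mul _).symm
    _ ≤ (1 + 4 * c * t) * (1 - 2 * c * t) * (k : ℝ) ^ p := by gcongr
    _ = (1 + 4 * c * t) * ((1 - 2 * c * t) * (k : ℝ) ^ p) := by ring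
    _ ≤ _ := by gcongr

end PowerSequences

/-! ### Abstract inertial schemes and contraction of their energy. -/

section InertialScheme

variable {X : Type*} [NormedAddCommGroup X] [InnerProductSpace ℝ X]

/-- Comparison of the gaps of two regularized objectives with nearby parameters. -/
theorem regularized_gap_change {D D' A A' κ u t t' nx nz nz' ns : ℝ} (hA : 0 < A)
    (hκ : 0 ≤ κ) (hκ1 : κ ≤ 1) (hu : 0 ≤ u) (ht' : 0 ≤ t') (hnx : 0 ≤ nx) (hnz' : 0 ≤ nz')
    (hDD : D ≤ D') (hDκ : D' ≤ (1 + κ) * D) (hAA : A' ≤ A) (hAκ : (1 - κ) * A ≤ A')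
    (hz : D * t + A / 2 * nz ≤ D * t' + A / 2 * nz') (hs : D * t + A / 2 * nz ≤ A / 2 * ns) :
    D' * (u - t') + A' / 2 * (nx - nz') ≤
      (1 + κ) * (D * (u - t) + A / 2 * (nx - nz)) + κ * (A * ns) := by
  have h1 : D' * u ≤ (1 + κ) * D * u := by gcongr
  have h2 : A' / 2 * nx ≤ (1 + κ) * (A / 2 * nx) := by
    have i1 : A' * nx ≤ A * nx := by gcongr
    have i2 : 0 ≤ κ * (A * nx) := by positivity
    linarith
  have h3 : (1 - κ) * D * t' ≤ D' * t' := by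
    gcongr
    nlinarith
  have h4 : (1 - κ) * A * nz' ≤ A' * nz' := by gcongr
  have h5 := mul_le_mul_of_nonneg_left hz (by linarith : 0 ≤ 1 - κ)
  have h6 := mul_le_mul_of_nonneg_left hs hκ
  linarith

/-- Standing assumptions on an inertial scheme
`v (k+1) - v k = -γ_k (x (k+1) - x k) - (D_k ∇g(x (k+1)) + A_k x (k+1))`, where
`v k = x k - x (k-1) + b ∇g(x k)`, `γ_k = cγ k^(-q)`, `A_k = cA k^(-p)`, together with the
Tikhonov points `z k` of `D_k g + A_k ‖·‖² / 2`. -/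
structure IsInertialScheme [CompleteSpace X] (g : X → ℝ) (b cA cγ p q : ℝ) (D : ℕ → ℝ) (s : X)
    (z x : ℕ → X) : Prop where
  convex : ConvexOn ℝ Set.univ g
  differentiable : Differentiable ℝ g
  b_pos : 0 < b
  cA_pos : 0 < cA
  cγ_pos : 0 < cγ
  q_pos : 0 < q
  one_lt_p : 1 < p
  q_le_p : q ≤ p
  D_pos : ∀ k, 1 ≤ k → 0 < D k
  D_mono : ∀ k, 1 ≤ k → D k ≤ D (k + 1)
  D_tendsto : Tendsto D atTop atTop
  D_growth : ∃ C, 0 ≤ C ∧ ∀ᶠ k : ℕ in atTop, D (k + 1) ≤ (1 + C / k) * D k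
  mem_argmin : s ∈ argminSet g
  tikhonov : ∀ k : ℕ, 1 ≤ k → IsTikhonovPoint g (cA * (k : ℝ) ^ (-p) / D k) (z k)
  recursion : ∀ k : ℕ, 1 ≤ k →
    x k - x (k - 1) + b • gradient g (x k) =
      (x (k + 1) - x k + b • gradient g (x (k + 1)))
        + (cγ * (k : ℝ) ^ (-q)) • (x (k + 1) - x k)
        + (D k • gradient g (x (k + 1)) + (cA * (k : ℝ) ^ (-p)) • x (k + 1))

/-- The gap of the regularized objective `D g + A ‖·‖² / 2` between `x` and `z`. -/
noncomputable def regularizedGap (g : X → ℝ) (D A : ℝ) (x z : X) : ℝ :=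
  D * (g x - g z) + A / 2 * (‖x‖ ^ 2 - ‖z‖ ^ 2)

/-- The energy of an inertial scheme at the iteration `k`. -/
noncomputable def schemeEnergy [CompleteSpace X] (g : X → ℝ) (b cA cγ p q : ℝ) (D : ℕ → ℝ)
    (z x : ℕ → X) (k : ℕ) : ℝ :=
  lyapunov (regularizedGap g (D k) (cA * (k : ℝ) ^ (-p)) (x k) (z k)) (cγ * (k : ℝ) ^ (-q))
    (x k - z k) (x k - x (k - 1) + b • gradient g (x k))

/-- The gradient inequality for `D g + A ‖·‖² / 2`, which is strongly convex with modulus `A`. It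
supplies both gap hypotheses of `lyapunov_step`: comparison with the previous iterate and with the
Tikhonov point. -/
theorem regularizedGap_sub_le [CompleteSpace X] {g : X → ℝ} (hg : ConvexOn ℝ Set.univ g)
    (hd : Differentiable ℝ g) {D : ℝ} (hD : 0 ≤ D) (A : ℝ) (x z : X) :
    regularizedGap g D A x z + A / 2 * ‖x - z‖ ^ 2 ≤
      inner ℝ (D • gradient g x + A • x) (x - z) := by
  have h1 := mul_le_mul_of_nonneg_left (hg.add_inner_gradient_le hd x z) hD
  rw [← neg_sub x z, inner_neg_right] at h1
  have h2 : inner ℝ x (x - z) = ‖x‖ ^ 2 - inner ℝ x z := by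
    rw [inner_sub_right, real_inner_self_eq_norm_sq]
  rw [inner_add_left, real_inner_smul_left, real_inner_smul_left, h2, norm_sub_sq_real]
  unfold regularizedGap
  linarith

theorem IsTikhonovPoint.mul_norm_sub_sq_le [CompleteSpace X] {g : X → ℝ}
    (hg : ConvexOn ℝ Set.univ g) (hd : Differentiable ℝ g) {D A : ℝ} (hD : 0 < D) {z : X}
    (h : IsTikhonovPoint g (A / D) z) (x : X) :
    A / 2 * ‖x - z‖ ^ 2 ≤ regularizedGap g D A x z := by
  have h1 := regularizedGap_sub_le hg hd hD.le A z x
  have h2 : D • gradient g z + A • z = 0 := by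
    have := congrArg (fun y => D • y) (h.gradient_eq hd)
    simpa [smul_smul, mul_div_cancel₀ _ hD.ne'] using this
  rw [h2, inner_zero_left, norm_sub_rev] at h1
  unfold regularizedGap at *
  linarith

variable [CompleteSpace X] {g : X → ℝ} {b cA cγ p q : ℝ} {D : ℕ → ℝ} {s : X} {z x : ℕ → X}

namespace IsInertialScheme

theorem param_pos (h : IsInertialScheme g b cA cγ p q D s z x) {k : ℕ} (hk : 1 ≤ k) :
    0 < cA * (k : ℝ) ^ (-p) := by
  have hk0 : (0 : ℝ) < k := by exact_mod_cast hk
  have := h.cA_pos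
  positivity

theorem damping_pos (h : IsInertialScheme g b cA cγ p q D s z x) {k : ℕ} (hk : 1 ≤ k) :
    0 < cγ * (k : ℝ) ^ (-q) := by
  have hk0 : (0 : ℝ) < k := by exact_mod_cast hk
  have := h.cγ_pos
  positivity

theorem norm_tikhonov_le (h : IsInertialScheme g b cA cγ p q D s z x) {k : ℕ} (hk : 1 ≤ k) :
    ‖z k‖ ≤ ‖s‖ :=
  (h.tikhonov k hk).norm_le (div_pos (h.param_pos hk) (h.D_pos k hk)) h.mem_argmin

theorem gap_nonneg (h : IsInertialScheme g b cA cγ p q D s z x) {k : ℕ} (hk : 1 ≤ k) (y : X) :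
    0 ≤ regularizedGap g (D k) (cA * (k : ℝ) ^ (-p)) y (z k) := by
  refine le_trans ?_ ((h.tikhonov k hk).mul_norm_sub_sq_le h.convex h.differentiable
    (h.D_pos k hk) y)
  have := h.param_pos hk
  positivity

theorem param_succ (h : IsInertialScheme g b cA cγ p q D s z x) {k : ℕ} (hk : 1 ≤ k) :
    cA * ((k + 1 : ℕ) : ℝ) ^ (-p) ≤ cA * (k : ℝ) ^ (-p) ∧
      (1 - p / k) * (cA * (k : ℝ) ^ (-p)) ≤ cA * ((k + 1 : ℕ) : ℝ) ^ (-p) := by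
  have hk0 : (0 : ℝ) < k := by exact_mod_cast hk
  have hA := h.cA_pos
  have hp := h.one_lt_p
  constructor
  · refine mul_le_mul_of_nonneg_left ?_ hA.le
    exact Real.rpow_le_rpow_of_nonpos hk0 (by push_cast; linarith) (by linarith)
  · have h1 := mul_le_mul_of_nonneg_left (one_sub_div_mul_rpow_le (by linarith : 0 ≤ p) hk) hA.le
    push_cast
    linarith

theorem damping_succ (h : IsInertialScheme g b cA cγ p q D s z x) {k : ℕ} (hk : 1 ≤ k) :
    cγ * ((k + 1 : ℕ) : ℝ) ^ (-q) ≤ cγ * (k : ℝ) ^ (-q) ∧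
      (1 - q / k) * (cγ * (k : ℝ) ^ (-q)) ≤ cγ * ((k + 1 : ℕ) : ℝ) ^ (-q) := by
  have hk0 : (0 : ℝ) < k := by exact_mod_cast hk
  have hA := h.cγ_pos
  have hq := h.q_pos
  constructor
  · refine mul_le_mul_of_nonneg_left ?_ hA.le
    exact Real.rpow_le_rpow_of_nonpos hk0 (by push_cast; linarith) (by linarith)
  · have h1 := mul_le_mul_of_nonneg_left (one_sub_div_mul_rpow_le hq.le hk) hA.le
    push_cast
    linarith

/-- The parameter `A / D` loses at most the fraction `(p + C) / k` in one step, and Tikhonov points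
move by at most the relative change of the parameter times their norm. -/
theorem norm_tikhonov_sub_succ_le (h : IsInertialScheme g b cA cγ p q D s z x) {k : ℕ}
    (hk : 1 ≤ k) {C : ℝ} (hC : 0 ≤ C) (hpk : p / k ≤ 1) (hD : D (k + 1) ≤ (1 + C / k) * D k) :
    ‖z k - z (k + 1)‖ ≤ (p + C) * ‖s‖ / k := by
  have hk0 : (0 : ℝ) < k := by exact_mod_cast hk
  have hA := h.param_pos hk
  have hA' := h.param_pos (Nat.le_add_left 1 k)
  have hDk := h.D_pos k hk
  have hDk' := h.D_pos (k + 1) (Nat.le_add_left 1 k)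
  obtain ⟨hA1, hA2⟩ := h.param_succ hk
  have h1 := (h.tikhonov k hk).mul_norm_sub_le h.convex h.differentiable
    (h.tikhonov (k + 1) (Nat.le_add_left 1 k))
  have h0 := h.norm_tikhonov_le (Nat.le_add_left 1 k)
  set A := cA * (k : ℝ) ^ (-p)
  set A' := cA * ((k + 1 : ℕ) : ℝ) ^ (-p)
  have h2 : A' / D (k + 1) ≤ A / D k := div_le_div₀ hA.le hA1 hDk (h.D_mono k hk)
  have h3 : (1 - (p + C) / k) * (A / D k) ≤ A' / D (k + 1) := by
    rw [le_div_iff₀ hDk', mul_comm, ← mul_assoc]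
    have hCk : 0 ≤ C / k := by positivity
    calc D (k + 1) * (1 - (p + C) / k) * (A / D k)
        ≤ D (k + 1) * ((1 - p / k) * (1 + C / k)⁻¹) * (A / D k) := by
          gcongr
          rw [← div_eq_mul_inv, le_div_iff₀ (by positivity), add_div]
          have hpk0 : 0 ≤ p / k := by have := h.one_lt_p; positivity
          nlinarith [mul_nonneg hpk0 hCk, mul_nonneg hCk hCk]
      _ ≤ (1 + C / k) * D k * ((1 - p / k) * (1 + C / k)⁻¹) * (A / D k) := by
          gcongr
      _ = (1 - p / k) * A := by field_simp
      _ ≤ A' := hA2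
  rw [abs_of_nonpos (by linarith)] at h1
  have h4 : 0 < A / D k := by positivity
  refine le_of_mul_le_mul_left (h1.trans ?_) h4
  have h5 : -(A' / D (k + 1) - A / D k) ≤ (p + C) / k * (A / D k) := by linarith
  calc -(A' / D (k + 1) - A / D k) * ‖z (k + 1)‖ ≤ (p + C) / k * (A / D k) * ‖s‖ := by
        gcongr
        have := h.one_lt_p
        positivity
    _ = _ := by ring

/-- Contraction of the energy at one (large) iteration. -/
theorem energy_succ_le (h : IsInertialScheme g b cA cγ p q D s z x) {k : ℕ} (hk : 1 ≤ k)
    {r κ C : ℝ} (hr : 0 < r) (hr1 : r ≤ 1) (h1 : 6 * r ≤ cγ * (k : ℝ) ^ (-q))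
    (h2 : 4 * r * (cγ * (k : ℝ) ^ (-q)) ≤ cA * (k : ℝ) ^ (-p)) (h3 : 3 * r * b ≤ D k)
    (h4 : cγ * (k : ℝ) ^ (-q) * b ≤ D k)
    (h5 : 16 * b * (cA * (k : ℝ) ^ (-p)) ≤ cγ * (k : ℝ) ^ (-q) * D k)
    (hC : 0 ≤ C) (hD : D (k + 1) ≤ (1 + C / k) * D k)
    (hκC : C / k ≤ κ) (hκp : p / k ≤ κ) (hκq : q / k ≤ κ) (hκs : (p + C) * ‖s‖ / k ≤ κ)
    (hκr : 8 * κ ≤ r) :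
    schemeEnergy g b cA cγ p q D z x (k + 1) ≤
      (1 - r / 4) * schemeEnergy g b cA cγ p q D z x k
        + 2 * b * (cA * (k : ℝ) ^ (-p)) ^ 2 / D k * ‖s‖ ^ 2
        + κ * (cA * (k : ℝ) ^ (-p) * ‖s‖ ^ 2)
        + 4 * (cγ * (k : ℝ) ^ (-q)) ^ 2 * κ ^ 2 / r := by
  have hk' : 1 ≤ k + 1 := Nat.le_add_left 1 k
  have hk0 : (0 : ℝ) < k := by exact_mod_cast hk
  have hb := h.b_pos
  have hA := h.param_pos hk
  have hγ := h.damping_pos hk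
  have hγ' := h.damping_pos hk'
  have hDk := h.D_pos k hk
  obtain ⟨hA1, hA2⟩ := h.param_succ hk
  obtain ⟨hγ1, hγ2⟩ := h.damping_succ hk
  have hzs := h.norm_tikhonov_le hk
  have hκ0 : 0 ≤ κ := le_trans (by positivity) hκC
  have hz := h.norm_tikhonov_sub_succ_le hk hC (by linarith) hD
  have hgap0 := h.gap_nonneg hk (x (k + 1))
  have hrec := h.recursion k hk
  have htik := h.tikhonov k hk
  have hmin : ∀ y, g s ≤ g y := fun y => h.mem_argmin (Set.mem_univ y)
  have hgapz := h.gap_nonneg hk (z (k + 1))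
  have hgaps := h.gap_nonneg hk s
  unfold schemeEnergy
  set A := cA * (k : ℝ) ^ (-p)
  set A' := cA * ((k + 1 : ℕ) : ℝ) ^ (-p)
  set γ := cγ * (k : ℝ) ^ (-q)
  set γ' := cγ * ((k + 1 : ℕ) : ℝ) ^ (-q)
  have hstep := lyapunov_step (z := z k) (y := x (k + 1) - z k) (w := x (k + 1) - x k)
    (v := x k - x (k - 1) + b • gradient g (x k)) (G := gradient g (x (k + 1)))
    (e := regularizedGap g (D k) A (x k) (z k))
    (e' := regularizedGap g (D k) A (x (k + 1)) (z k))
    hγ hb hDk hA hr h1 h2 h3 h4 h5 rfl (by rw [sub_add_cancel]; exact hrec)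
    (by
      rw [sub_add_cancel]
      refine le_trans ?_ (regularizedGap_sub_le h.convex h.differentiable hDk.le A _ _)
      have : 0 ≤ A / 2 * ‖x (k + 1) - x k‖ ^ 2 := by positivity
      unfold regularizedGap
      linarith)
    (by
      rw [sub_add_cancel]
      exact regularizedGap_sub_le h.convex h.differentiable hDk.le A _ _) hgap0
  rw [sub_sub_sub_cancel_left] at hstep
  have hchange := lyapunov_change (x := x (k + 1)) (z := z k) (z' := z (k + 1))
    (v := x (k + 1) - x k + b • gradient g (x (k + 1)))
    (e' := regularizedGap g (D (k + 1)) A' (x (k + 1)) (z (k + 1)))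
    (s := κ * (A * ‖s‖ ^ 2)) hγ' hgap0 hr (by linarith) hκ0 hκr hγ1
    (by
      have := mul_le_mul_of_nonneg_right hκq hγ.le
      linarith) (hz.trans hκs)
    (by
      have i0 := regularized_gap_change (D := D k) (D' := D (k + 1)) (A := A) (A' := A') (κ := κ)
        (u := g (x (k + 1)) - g s) (t := g (z k) - g s) (t' := g (z (k + 1)) - g s)
        (nx := ‖x (k + 1)‖ ^ 2) (nz := ‖z k‖ ^ 2) (nz' := ‖z (k + 1)‖ ^ 2) (ns := ‖s‖ ^ 2)
        hA hκ0 (by linarith) (sub_nonneg.2 (hmin _)) (sub_nonneg.2 (hmin _)) (by positivity)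
        (by positivity) (h.D_mono k hk)
        (hD.trans (by gcongr)) hA1
        (le_trans (by gcongr) hA2)
        (by unfold regularizedGap at hgapz; linarith)
        (by unfold regularizedGap at hgaps; linarith)
      simp only [sub_sub_sub_cancel_right] at i0
      exact i0)
  have hk1 : k + 1 - 1 = k := rfl
  rw [hk1]
  have hF : 0 ≤ lyapunov (regularizedGap g (D k) A (x (k + 1)) (z k)) γ (x (k + 1) - z k)
      (x (k + 1) - x k + b • gradient g (x (k + 1))) := by
    unfold lyapunov
    positivity
  have hs2 : 2 * b * A ^ 2 / D k * ‖z k‖ ^ 2 ≤ 2 * b * A ^ 2 / D k * ‖s‖ ^ 2 := by gcongr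
  have hs0 : 0 ≤ 2 * b * A ^ 2 / D k * ‖s‖ ^ 2 := by positivity
  set F' := lyapunov (regularizedGap g (D k) A (x (k + 1)) (z k)) γ (x (k + 1) - z k)
      (x (k + 1) - x k + b • gradient g (x (k + 1)))
  -- The gain `1 + r` of the frozen step beats the loss `1 + r / 2` of the parameter change because
  -- `r ≤ 1`.
  have i1 : (1 + r / 2) * F' ≤ (1 - r / 4) * ((1 + r) * F') := by
    have : 0 ≤ F' * (r * (1 - r)) := mul_nonneg hF (mul_nonneg hr.le (by linarith))
    linarith
  have i2 := mul_le_mul_of_nonneg_left (hstep.trans (add_le_add_right hs2 _))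
    (by linarith : 0 ≤ 1 - r / 4)
  have i3 : 0 ≤ r / 4 * (2 * b * A ^ 2 / D k * ‖s‖ ^ 2) := by positivity
  linarith

end IsInertialScheme

end InertialScheme

/-! ### Decay of the energy and what it controls. -/

namespace IsInertialScheme

variable {X : Type*} [NormedAddCommGroup X] [InnerProductSpace ℝ X] [CompleteSpace X]
  {g : X → ℝ} {b cA cγ p q : ℝ} {D : ℕ → ℝ} {s : X} {z x : ℕ → X}

/-- Polynomial decay of the energy. -/
theorem exists_energy_le (h : IsInertialScheme g b cA cγ p q D s z x) {m ω : ℝ} (hqm : q ≤ m)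
    (hpm : p ≤ m + q) (hm1 : m < 1) (hω : 0 ≤ ω) (hω1 : ω ≤ 1 + p - m)
    (hω2 : ω ≤ 2 + 2 * q - 2 * m) :
    ∃ M, 0 ≤ M ∧ ∀ᶠ k : ℕ in atTop,
      schemeEnergy g b cA cγ p q D z x k ≤ M * (k : ℝ) ^ (-ω) := by
  obtain ⟨C, hC, hDC⟩ := h.D_growth
  have hb := h.b_pos
  have hcA := h.cA_pos
  have hcγ := h.cγ_pos
  have hq := h.q_pos
  have hp := h.one_lt_p
  have hm0 : 0 < m := hq.trans_le hqm
  -- With `r = c k^(-m)`, the three entries give `r ≤ 1`, `6 r ≤ γ` (using `q ≤ m`) and `4 r γ ≤ A`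
  -- (using `p ≤ m + q`). The conditions involving `D` hold eventually since `D → ∞`.
  set c := min 1 (min (cγ / 6) (cA / (4 * cγ))) with hc
  have hc0 : 0 < c := by
    have : 0 < cγ / 6 := by positivity
    have : 0 < cA / (4 * cγ) := by positivity
    simp_all
  have hc1 : c ≤ 1 := min_le_left _ _
  have hc2 : c * 6 ≤ cγ :=
    (le_div_iff₀ (by norm_num)).1 ((min_le_right _ _).trans (min_le_left _ _))
  have hc3 : c * (4 * cγ) ≤ cA :=
    (le_div_iff₀ (by positivity)).1 ((min_le_right _ _).trans (min_le_right _ _))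
  -- `K / k` dominates every drift at once: those of `D`, `A`, `γ` and of the Tikhonov point.
  set K := C + p + q + (p + C) * ‖s‖ with hK
  have hKs : 0 ≤ (p + C) * ‖s‖ := by positivity
  have hK0 : 0 ≤ K := by positivity
  refine exists_eventually_le_mul_rpow_neg (c := c / 4) (m := m)
    (C := 2 * b * cA ^ 2 * ‖s‖ ^ 2 + K * cA * ‖s‖ ^ 2 + 4 * cγ ^ 2 * K ^ 2 / c)
    (by positivity) hm0 hm1 hω ?_
  filter_upwards [hDC, eventually_ge_atTop 1, h.D_tendsto.eventually_ge_atTop (3 * b),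
    h.D_tendsto.eventually_ge_atTop (cγ * b), h.D_tendsto.eventually_ge_atTop (16 * b * cA / cγ),
    h.D_tendsto.eventually_ge_atTop 1, eventually_div_le_mul_rpow_neg (8 * K) hc0 hm1]
    with k hD hk hD1 hD2 hD3 hD4 hκr
  have hk0 : (0 : ℝ) < k := by exact_mod_cast hk
  have hle1 : ∀ a : ℝ, 0 < a → (k : ℝ) ^ (-a) ≤ 1 := fun a ha =>
    Real.rpow_le_one_of_one_le_of_nonpos (by exact_mod_cast hk) (by linarith)
  have hr1 : c * (k : ℝ) ^ (-m) ≤ 1 := mul_le_one₀ hc1 (by positivity) (hle1 m hm0)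
  have hkκ : ∀ a, a ≤ K → a / k ≤ K / k := fun a ha => by gcongr
  have hmain := h.energy_succ_le hk (r := c * (k : ℝ) ^ (-m)) (κ := K / k) (by positivity) hr1
    (by
      calc 6 * (c * (k : ℝ) ^ (-m)) = c * 6 * (k : ℝ) ^ (-m) := by ring
        _ ≤ cγ * (k : ℝ) ^ (-q) := by
          gcongr
          exact_mod_cast hk)
    (by
      calc 4 * (c * (k : ℝ) ^ (-m)) * (cγ * (k : ℝ) ^ (-q))
          = c * (4 * cγ) * ((k : ℝ) ^ (-m) * (k : ℝ) ^ (-q)) := by ring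
        _ ≤ cA * (k : ℝ) ^ (-p) := by
          rw [← Real.rpow_add hk0]
          gcongr
          · exact_mod_cast hk
          · linarith)
    (by
      have := mul_le_mul_of_nonneg_right hr1 hb.le
      linarith)
    (by
      have := mul_le_mul_of_nonneg_left (hle1 q hq) (by positivity : 0 ≤ cγ * b)
      linarith)
    (by
      rw [div_le_iff₀ hcγ] at hD3
      calc 16 * b * (cA * (k : ℝ) ^ (-p)) = 16 * b * cA * (k : ℝ) ^ (-p) := by ring
        _ ≤ D k * cγ * (k : ℝ) ^ (-q) := by
          have hD0 := h.D_pos k hk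
          gcongr
          · exact_mod_cast hk
          · exact h.q_le_p
        _ = _ := by ring)
    hC hD (hkκ _ (by linarith)) (hkκ _ (by linarith)) (hkκ _ (by linarith)) (hkκ _ (by linarith))
    (by rw [← mul_div_assoc]; exact hκr)
  refine hmain.trans ?_
  -- The three sources have orders `k^(-2p)` (for `D ≥ 1`), `k^(-1-p)` and `k^(m-2-2q)`. The last
  -- two match the two upper bounds on `ω`; the first is dominated by the second because `p > 1`.
  have e0 : 2 * b * (cA * (k : ℝ) ^ (-p)) ^ 2 / D k * ‖s‖ ^ 2 ≤
      2 * b * cA ^ 2 * ‖s‖ ^ 2 * (k : ℝ) ^ (-m - ω) := by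
    have i1 : ((k : ℝ) ^ (-p)) ^ 2 ≤ (k : ℝ) ^ (-m - ω) := by
      rw [sq, ← Real.rpow_add hk0]
      exact rpow_natCast_le_rpow (by linarith) hk
    calc 2 * b * (cA * (k : ℝ) ^ (-p)) ^ 2 / D k * ‖s‖ ^ 2
        ≤ 2 * b * (cA * (k : ℝ) ^ (-p)) ^ 2 * ‖s‖ ^ 2 := by
          gcongr
          exact div_le_self (by positivity) hD4
      _ = 2 * b * cA ^ 2 * ‖s‖ ^ 2 * ((k : ℝ) ^ (-p)) ^ 2 := by ring
      _ ≤ _ := by gcongr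
  have e1 : K / k * (cA * (k : ℝ) ^ (-p) * ‖s‖ ^ 2) ≤
      K * cA * ‖s‖ ^ 2 * (k : ℝ) ^ (-m - ω) := by
    have i1 : (k : ℝ) ^ (-p) / k ≤ (k : ℝ) ^ (-m - ω) := by
      rw [← Real.rpow_sub_one hk0.ne']
      exact rpow_natCast_le_rpow (by linarith) hk
    calc K / k * (cA * (k : ℝ) ^ (-p) * ‖s‖ ^ 2) =
        K * cA * ‖s‖ ^ 2 * ((k : ℝ) ^ (-p) / k) := by ring
      _ ≤ _ := by gcongr
  have e2 : 4 * (cγ * (k : ℝ) ^ (-q)) ^ 2 * (K / k) ^ 2 / (c * (k : ℝ) ^ (-m)) ≤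
      4 * cγ ^ 2 * K ^ 2 / c * (k : ℝ) ^ (-m - ω) := by
    have i1 : ((k : ℝ) ^ (-q)) ^ 2 / (k : ℝ) ^ 2 / (k : ℝ) ^ (-m) ≤ (k : ℝ) ^ (-m - ω) := by
      rw [← Real.rpow_natCast, ← Real.rpow_natCast, ← Real.rpow_mul hk0.le, ← Real.rpow_sub hk0,
        ← Real.rpow_sub hk0]
      refine rpow_natCast_le_rpow ?_ hk
      push_cast
      linarith
    calc 4 * (cγ * (k : ℝ) ^ (-q)) ^ 2 * (K / k) ^ 2 / (c * (k : ℝ) ^ (-m)) =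
        4 * cγ ^ 2 * K ^ 2 / c * (((k : ℝ) ^ (-q)) ^ 2 / (k : ℝ) ^ 2 / (k : ℝ) ^ (-m)) := by
          field_simp
      _ ≤ _ := by gcongr
  have e3 : 1 - c * (k : ℝ) ^ (-m) / 4 = 1 - c / 4 * (k : ℝ) ^ (-m) := by ring
  rw [e3]
  linarith

theorem gap_le_energy (k : ℕ) :
    regularizedGap g (D k) (cA * (k : ℝ) ^ (-p)) (x k) (z k) ≤
      schemeEnergy g b cA cγ p q D z x k := by
  unfold schemeEnergy lyapunov
  have h1 : 0 ≤ 1 / 2 * ‖(cγ * (k : ℝ) ^ (-q) / 2) • (x k - z k)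
    + (x k - x (k - 1) + b • gradient g (x k))‖ ^ 2 := by positivity
  have h2 : 0 ≤ (cγ * (k : ℝ) ^ (-q)) ^ 2 / 8 * ‖x k - z k‖ ^ 2 := by positivity
  linarith

theorem param_mul_norm_sub_sq_le_energy (h : IsInertialScheme g b cA cγ p q D s z x) {k : ℕ}
    (hk : 1 ≤ k) :
    cA * (k : ℝ) ^ (-p) / 2 * ‖x k - z k‖ ^ 2 ≤ schemeEnergy g b cA cγ p q D z x k :=
  ((h.tikhonov k hk).mul_norm_sub_sq_le h.convex h.differentiable (h.D_pos k hk) _).trans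
    (gap_le_energy k)

/-- A second control of the distance, with weight of order `k^(-2q)` instead of `k^(-p)`; its order
is the better one when `2q < p`. -/
theorem damping_sq_mul_norm_sub_sq_le_energy (h : IsInertialScheme g b cA cγ p q D s z x) {k : ℕ}
    (hk : 1 ≤ k) :
    (cγ * (k : ℝ) ^ (-q)) ^ 2 / 8 * ‖x k - z k‖ ^ 2 ≤ schemeEnergy g b cA cγ p q D z x k := by
  have h0 := h.gap_nonneg hk (x k)
  unfold schemeEnergy lyapunov
  have h1 : 0 ≤ 1 / 2 * ‖(cγ * (k : ℝ) ^ (-q) / 2) • (x k - z k)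
    + (x k - x (k - 1) + b • gradient g (x k))‖ ^ 2 := by positivity
  linarith

/-- The gaps of `x k` and of `s` share the reference point `z k`; subtracting them and using that
the gap of `s` is nonnegative eliminates it. -/
theorem value_le_energy (h : IsInertialScheme g b cA cγ p q D s z x) {k : ℕ} (hk : 1 ≤ k) :
    D k * (g (x k) - g s) ≤
      schemeEnergy g b cA cγ p q D z x k + cA * (k : ℝ) ^ (-p) / 2 * ‖s‖ ^ 2 := by
  have h0 := h.gap_nonneg hk s
  have h1 := gap_le_energy (g := g) (b := b) (cA := cA) (cγ := cγ) (p := p) (q := q) (D := D)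
    (z := z) (x := x) k
  have h2 : 0 ≤ cA * (k : ℝ) ^ (-p) / 2 * ‖x k‖ ^ 2 := by
    have := h.param_pos hk
    positivity
  unfold regularizedGap at h0 h1
  linarith

theorem norm_velocity_sq_le_energy (h : IsInertialScheme g b cA cγ p q D s z x) {k : ℕ}
    (hk : 1 ≤ k) :
    ‖x k - x (k - 1) + b • gradient g (x k)‖ ^ 2 ≤ 8 * schemeEnergy g b cA cγ p q D z x k := by
  have h0 := h.gap_nonneg hk (x k)
  unfold schemeEnergy lyapunov
  set γ := cγ * (k : ℝ) ^ (-q)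
  set v := x k - x (k - 1) + b • gradient g (x k)
  set y := x k - z k
  have h1 : ‖v‖ ^ 2 ≤ 2 * ‖(γ / 2) • y + v‖ ^ 2 + 2 * ‖(γ / 2) • y‖ ^ 2 := by
    have := parallelogram_law_with_norm ℝ ((γ / 2) • y + v) ((γ / 2) • y)
    rw [add_sub_cancel_left] at this
    nlinarith [sq_nonneg ‖(γ / 2) • y + v + (γ / 2) • y‖]
  rw [norm_smul (γ / 2) y, Real.norm_eq_abs, mul_pow, sq_abs] at h1
  have h2 : 0 ≤ ‖(γ / 2) • y + v‖ ^ 2 := by positivity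
  have h3 : 0 ≤ γ ^ 2 * ‖y‖ ^ 2 := by positivity
  linarith

/-- The second bound makes the Tikhonov force relative to `z k` as small as the velocity: `A² ‖x -
z‖² ≤ 2 A E`, with `A` bounded. -/
theorem exists_norm_velocity_le {M ω : ℝ} (h : IsInertialScheme g b cA cγ p q D s z x)
    (hM : ∀ᶠ k : ℕ in atTop, schemeEnergy g b cA cγ p q D z x k ≤ M * (k : ℝ) ^ (-ω)) :
    ∀ᶠ k : ℕ in atTop,
      ‖x k - x (k - 1) + b • gradient g (x k)‖ ≤ √(8 * M) * (k : ℝ) ^ (-(ω / 2)) ∧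
      cA * (k : ℝ) ^ (-p) * ‖x k - z k‖ ≤ √(2 * cA * M) * (k : ℝ) ^ (-(ω / 2)) := by
  filter_upwards [hM, eventually_ge_atTop 1] with k hE hk
  have hk0 : (0 : ℝ) < k := by exact_mod_cast hk
  have e : (k : ℝ) ^ (-ω) = ((k : ℝ) ^ (-(ω / 2))) ^ 2 := by
    rw [← Real.rpow_natCast, ← Real.rpow_mul hk0.le]
    congr 1
    push_cast
    ring
  have aux : ∀ t N : ℝ, t ^ 2 ≤ N * (k : ℝ) ^ (-ω) → t ≤ √N * (k : ℝ) ^ (-(ω / 2)) := by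
    intro t N ht
    have h1 := Real.le_sqrt_of_sq_le ht
    rwa [e, Real.sqrt_mul' _ (by positivity), Real.sqrt_sq (by positivity)] at h1
  constructor
  · refine aux _ _ ((h.norm_velocity_sq_le_energy hk).trans ?_)
    linarith
  · refine aux _ _ ?_
    have h1 := (h.param_mul_norm_sub_sq_le_energy hk).trans hE
    have h2 := h.param_pos hk
    have hp := h.one_lt_p
    have hcA := h.cA_pos
    have h3 : cA * (k : ℝ) ^ (-p) ≤ cA := by
      have := Real.rpow_le_one_of_one_le_of_nonpos (x := (k : ℝ)) (z := -p)
        (by exact_mod_cast hk) (by linarith)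
      exact mul_le_of_le_one_right h.cA_pos.le this
    calc (cA * (k : ℝ) ^ (-p) * ‖x k - z k‖) ^ 2
        = 2 * (cA * (k : ℝ) ^ (-p)) * (cA * (k : ℝ) ^ (-p) / 2 * ‖x k - z k‖ ^ 2) := by ring
      _ ≤ 2 * cA * (M * (k : ℝ) ^ (-ω)) := by gcongr
      _ = _ := by ring

/-- Decay of the gradients and of the velocities. -/
theorem exists_gradient_le {M ω : ℝ} (h : IsInertialScheme g b cA cγ p q D s z x)
    (hω : 0 ≤ ω) (hωp : ω / 2 ≤ p)
    (hM : ∀ᶠ k : ℕ in atTop, schemeEnergy g b cA cγ p q D z x k ≤ M * (k : ℝ) ^ (-ω)) :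
    ∃ N, ∀ᶠ k : ℕ in atTop, D k * ‖gradient g (x k)‖ ≤ N * (k : ℝ) ^ (-(ω / 2)) ∧
      ‖x k - x (k - 1)‖ ≤ N * (k : ℝ) ^ (-(ω / 2)) := by
  obtain ⟨C, hC, hDC⟩ := h.D_growth
  have hb := h.b_pos
  have hcA := h.cA_pos
  have hcγ := h.cγ_pos
  have hq := h.q_pos
  have hp := h.one_lt_p
  set V := √(8 * M)
  set W := √(2 * cA * M)
  have hV : 0 ≤ V := Real.sqrt_nonneg _
  have hW : 0 ≤ W := Real.sqrt_nonneg _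
  -- The summands bound `v'`, `v`, `γ v'` and `A x (k + 1)`; the powers of 2 pay for passing from
  -- index `k` to `k + 1`. The factor 4 comes from `D (k + 1) ≤ 2 D k` and `D k - γ b ≥ D k / 2`.
  set N := 4 * (V + 2 ^ (ω / 2) * V + cγ * V + (2 ^ p * W + 2 ^ p * cA * ‖s‖)) with hN
  have hN0 : 0 ≤ N := by positivity
  refine ⟨V + (1 + b) * N, ?_⟩
  have key : ∀ᶠ k : ℕ in atTop, D (k + 1) * ‖gradient g (x (k + 1))‖ ≤
      N * ((k + 1 : ℕ) : ℝ) ^ (-(ω / 2)) := by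
    have hvel := h.exists_norm_velocity_le hM
    have hvel' := (tendsto_add_atTop_nat 1).eventually hvel
    filter_upwards [hvel, hvel', hDC, eventually_ge_atTop 1,
      h.D_tendsto.eventually_ge_atTop (2 * (cγ * b)),
      (tendsto_const_div_atTop_nhds_zero_nat C).eventually_le_const one_pos]
      with k h1 h2 hD hk hD2 hCk
    have hk' : 1 ≤ k + 1 := Nat.le_add_left 1 k
    have hk0 : (0 : ℝ) < k := by exact_mod_cast hk
    have hD0 := h.D_pos k hk
    have hγ0 := h.damping_pos hk
    have hA0 := h.param_pos hk
    have hrec := h.recursion k hk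
    have hzs := h.norm_tikhonov_le hk'
    have hγ : cγ * (k : ℝ) ^ (-q) ≤ cγ := by
      have := Real.rpow_le_one_of_one_le_of_nonpos (x := (k : ℝ)) (z := -q)
        (by exact_mod_cast hk) (by linarith)
      exact mul_le_of_le_one_right hcγ.le this
    have hA : cA * (k : ℝ) ^ (-p) ≤ 2 ^ p * (cA * ((k + 1 : ℕ) : ℝ) ^ (-p)) := by
      have := mul_le_mul_of_nonneg_left
        (rpow_neg_le_mul_succ_rpow_neg (by linarith : 0 ≤ p) hk) hcA.le
      linarith
    have hP := rpow_neg_le_mul_succ_rpow_neg (by linarith : 0 ≤ ω / 2) hk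
    have hPp : ((k + 1 : ℕ) : ℝ) ^ (-p) ≤ ((k + 1 : ℕ) : ℝ) ^ (-(ω / 2)) :=
      rpow_natCast_le_rpow (by linarith) hk'
    set γ := cγ * (k : ℝ) ^ (-q)
    set A := cA * (k : ℝ) ^ (-p)
    have hk1 : k + 1 - 1 = k := rfl
    rw [hk1] at h2
    set G := gradient g (x (k + 1))
    set v := x k - x (k - 1) + b • gradient g (x k)
    set v' := x (k + 1) - x k + b • G with hv'
    set P := ((k + 1 : ℕ) : ℝ) ^ (-(ω / 2))
    have hP0 : 0 ≤ P := by positivity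
    -- Replacing the increment by `v' - b • G` in the damping term lets the recursion be solved for
    -- the new gradient.
    have hG : (D k - γ * b) • G = v - v' - γ • v' - A • x (k + 1) := by
      rw [hrec, hv']
      module
    have hv1 : ‖v‖ ≤ 2 ^ (ω / 2) * V * P :=
      calc ‖v‖ ≤ V * (2 ^ (ω / 2) * P) := h1.1.trans (by gcongr)
        _ = _ := by ring
    have hAx : A * ‖x (k + 1)‖ ≤ (2 ^ p * W + 2 ^ p * cA * ‖s‖) * P := by
      have i1 : ‖x (k + 1)‖ ≤ ‖x (k + 1) - z (k + 1)‖ + ‖s‖ := by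
        have := norm_add_le (x (k + 1) - z (k + 1)) (z (k + 1))
        rw [sub_add_cancel] at this
        linarith
      calc A * ‖x (k + 1)‖ ≤ 2 ^ p * (cA * ((k + 1 : ℕ) : ℝ) ^ (-p)) *
            (‖x (k + 1) - z (k + 1)‖ + ‖s‖) := by gcongr
        _ = 2 ^ p * (cA * ((k + 1 : ℕ) : ℝ) ^ (-p) * ‖x (k + 1) - z (k + 1)‖)
            + 2 ^ p * cA * ‖s‖ * ((k + 1 : ℕ) : ℝ) ^ (-p) := by ring
        _ ≤ 2 ^ p * (W * P) + 2 ^ p * cA * ‖s‖ * P := by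
            refine add_le_add (mul_le_mul_of_nonneg_left h2.2 (by positivity)) ?_
            gcongr
        _ = _ := by ring
    have hnorm : (D k - γ * b) * ‖G‖ ≤ ‖v‖ + ‖v'‖ + γ * ‖v'‖ + A * ‖x (k + 1)‖ := by
      have hγb : γ * b ≤ cγ * b := by gcongr
      have i0 : 0 ≤ D k - γ * b := by linarith
      rw [← Real.norm_of_nonneg i0, ← norm_smul, hG]
      refine (norm_sub_le _ _).trans ?_
      rw [norm_smul, Real.norm_of_nonneg hA0.le]
      gcongr
      refine (norm_sub_le _ _).trans ?_
      rw [norm_smul, Real.norm_of_nonneg hγ0.le]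
      gcongr
      exact norm_sub_le _ _
    have hγv : γ * ‖v'‖ ≤ cγ * (V * P) := by
      gcongr
      exact h2.1
    have hhalf : D k / 2 * ‖G‖ ≤ (D k - γ * b) * ‖G‖ := by
      have hγb : γ * b ≤ cγ * b := by gcongr
      gcongr
      linarith
    have hDD : D (k + 1) * ‖G‖ ≤ 4 * (D k / 2 * ‖G‖) := by
      have : D (k + 1) ≤ 2 * D k := hD.trans (by gcongr; linarith)
      calc D (k + 1) * ‖G‖ ≤ 2 * D k * ‖G‖ := by gcongr
        _ = _ := by ring
    have h21 := h2.1
    rw [hN]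
    linarith
  have key' : ∀ᶠ k : ℕ in atTop, D k * ‖gradient g (x k)‖ ≤ N * (k : ℝ) ^ (-(ω / 2)) := by
    obtain ⟨n, hn⟩ := eventually_atTop.1 key
    refine eventually_atTop.2 ⟨n + 1, fun k hk => ?_⟩
    obtain ⟨j, rfl⟩ := Nat.exists_eq_add_of_le' (Nat.le_of_add_left_le hk)
    exact hn j (by omega)
  filter_upwards [key', h.exists_norm_velocity_le hM, h.D_tendsto.eventually_ge_atTop 1]
    with k h1 h2 hD
  have hP0 : 0 ≤ (k : ℝ) ^ (-(ω / 2)) := by positivity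
  have hNP : 0 ≤ N * (k : ℝ) ^ (-(ω / 2)) := by positivity
  have hVP : 0 ≤ V * (k : ℝ) ^ (-(ω / 2)) := by positivity
  have hbNP : 0 ≤ b * (N * (k : ℝ) ^ (-(ω / 2))) := by positivity
  refine ⟨by linarith, ?_⟩
  have h3 : ‖gradient g (x k)‖ ≤ N * (k : ℝ) ^ (-(ω / 2)) :=
    (le_mul_of_one_le_left (norm_nonneg _) hD).trans h1
  have h4 := norm_sub_le (x k - x (k - 1) + b • gradient g (x k)) (b • gradient g (x k))
  rw [add_sub_cancel_right, norm_smul, Real.norm_of_nonneg hb.le] at h4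
  have h5 := mul_le_mul_of_nonneg_left h3 hb.le
  linarith [h2.1]

end IsInertialScheme

/-! ### From energy decay to convergence rates. -/

section Rates

variable {X : Type*} [NormedAddCommGroup X] [InnerProductSpace ℝ X] [CompleteSpace X]

/-- Convergence rates of an inertial scheme in terms of the decay exponent `ω` of its energy. -/
theorem IsInertialScheme.isBigO_rates {g : X → ℝ} {b cA cγ p q c : ℝ} {δ : ℕ → ℝ} {s : X}
    {z x : ℕ → X} (h : IsInertialScheme g b cA cγ p q (fun k => c * δ k) s z x) (hc : 0 < c)
    {m ω τ σ ρ : ℝ} (hqm : q ≤ m) (hpm : p ≤ m + q) (hm1 : m < 1) (hω : 0 ≤ ω)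
    (hω1 : ω ≤ 1 + p - m) (hω2 : ω ≤ 2 + 2 * q - 2 * m) (hωp : ω ≤ 2 * p)
    (hτω : τ ≤ ω) (hτp : τ ≤ p) (hσ : 2 * σ ≤ ω - p ∨ 2 * σ ≤ ω - 2 * q) (hρ : ρ = ω / 2) :
    (fun k : ℕ => g (x k) - g s) =O[atTop] (fun k : ℕ => 1 / ((k : ℝ) ^ τ * δ k)) ∧
    (fun k : ℕ => ‖x k - z k‖) =O[atTop] (fun k : ℕ => 1 / (k : ℝ) ^ σ) ∧
    (fun k : ℕ => ‖gradient g (x k)‖) =O[atTop] (fun k : ℕ => 1 / ((k : ℝ) ^ ρ * δ k)) ∧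
    (fun k : ℕ => ‖x k - x (k - 1)‖) =O[atTop] (fun k : ℕ => 1 / (k : ℝ) ^ ρ) := by
  have hcA := h.cA_pos
  have hcγ := h.cγ_pos
  obtain ⟨M, hM0, hM⟩ := h.exists_energy_le hqm hpm hm1 hω hω1 hω2
  obtain ⟨N, hN⟩ := h.exists_gradient_le hω (by linarith) hM
  subst hρ
  have hδ : ∀ k, 1 ≤ k → 0 < δ k := fun k hk => pos_of_mul_pos_right (h.D_pos k hk) hc.le
  have hbound : ∀ (f e : ℕ → ℝ) (a K : ℝ), (∀ᶠ k : ℕ in atTop, 0 ≤ f k) →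
      (∀ k, 1 ≤ k → 0 < e k) → (∀ᶠ k : ℕ in atTop, e k * f k ≤ K * (k : ℝ) ^ (-a)) →
      f =O[atTop] (fun k : ℕ => 1 / ((k : ℝ) ^ a * e k)) := by
    intro f e a K hf he hfe
    refine IsBigO.of_bound K ?_
    filter_upwards [hf, hfe, eventually_ge_atTop 1] with k h0 h1 hk
    have hk0 : (0 : ℝ) < k := by exact_mod_cast hk
    have he0 := he k hk
    rw [Real.norm_of_nonneg h0, Real.norm_of_nonneg (by positivity)]
    rw [mul_comm, ← le_div_iff₀ he0, Real.rpow_neg hk0.le] at h1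
    refine h1.trans_eq ?_
    field_simp
  refine ⟨?_, ?_, ?_, ?_⟩
  · refine hbound _ δ τ ((M + cA / 2 * ‖s‖ ^ 2) / c)
      (Eventually.of_forall fun k => sub_nonneg.2 (h.mem_argmin (Set.mem_univ _))) hδ ?_
    filter_upwards [hM, eventually_ge_atTop 1] with k h1 hk
    have h2 := h.value_le_energy hk
    have h3 : (k : ℝ) ^ (-ω) ≤ (k : ℝ) ^ (-τ) := rpow_natCast_le_rpow (by linarith) hk
    have h4 : (k : ℝ) ^ (-p) ≤ (k : ℝ) ^ (-τ) := rpow_natCast_le_rpow (by linarith) hk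
    have h5 := mul_le_mul_of_nonneg_left h3 hM0
    have h6 := mul_le_mul_of_nonneg_left h4 (by positivity : 0 ≤ cA / 2 * ‖s‖ ^ 2)
    rw [div_mul_eq_mul_div, le_div_iff₀ hc]
    linarith
  · have hsq : ∃ L, ∀ᶠ k : ℕ in atTop, ‖x k - z k‖ ^ 2 ≤ L * (k : ℝ) ^ (-(2 * σ)) := by
      -- The two alternatives use the Tikhonov weight `k^(-p)` and the damping weight `k^(-2q)` in
      -- the energy, respectively.
      rcases hσ with hσ | hσ
      · refine ⟨2 * M / cA, ?_⟩
        filter_upwards [hM, eventually_ge_atTop 1] with k h1 hk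
        have hk0 : (0 : ℝ) < k := by exact_mod_cast hk
        have h2 := (h.param_mul_norm_sub_sq_le_energy hk).trans h1
        have h3 : (k : ℝ) ^ (-ω) ≤ (k : ℝ) ^ (-p) * (k : ℝ) ^ (-(2 * σ)) := by
          rw [← Real.rpow_add hk0]
          exact rpow_natCast_le_rpow (by linarith) hk
        have h4 := mul_le_mul_of_nonneg_left h3 hM0
        have h5 : 0 < cA * (k : ℝ) ^ (-p) / 2 := by positivity
        refine le_of_mul_le_mul_left ((h2.trans h4).trans_eq ?_) h5
        field_simp
      · refine ⟨8 * M / cγ ^ 2, ?_⟩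
        filter_upwards [hM, eventually_ge_atTop 1] with k h1 hk
        have hk0 : (0 : ℝ) < k := by exact_mod_cast hk
        have h2 := (h.damping_sq_mul_norm_sub_sq_le_energy hk).trans h1
        have h3 : (k : ℝ) ^ (-ω) ≤ ((k : ℝ) ^ (-q)) ^ 2 * (k : ℝ) ^ (-(2 * σ)) := by
          rw [sq, ← Real.rpow_add hk0, ← Real.rpow_add hk0]
          exact rpow_natCast_le_rpow (by linarith) hk
        have h4 := mul_le_mul_of_nonneg_left h3 hM0
        have h5 : 0 < (cγ * (k : ℝ) ^ (-q)) ^ 2 / 8 := by positivity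
        refine le_of_mul_le_mul_left ((h2.trans h4).trans_eq ?_) h5
        field_simp
    obtain ⟨L, hL⟩ := hsq
    have := hbound (fun k => ‖x k - z k‖) (fun _ => 1) σ √L
      (Eventually.of_forall fun k => norm_nonneg _) (fun _ _ => one_pos) (by
        filter_upwards [hL, eventually_ge_atTop 1] with k h1 hk
        have hk0 : (0 : ℝ) < k := by exact_mod_cast hk
        have e : (k : ℝ) ^ (-(2 * σ)) = ((k : ℝ) ^ (-σ)) ^ 2 := by
          rw [← Real.rpow_natCast, ← Real.rpow_mul hk0.le]
          congr 1
          push_cast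
          ring
        have h2 := Real.le_sqrt_of_sq_le h1
        rw [e, Real.sqrt_mul' _ (by positivity), Real.sqrt_sq (by positivity)] at h2
        rwa [one_mul])
    simpa using this
  · refine hbound _ δ (ω / 2) (N / c) (Eventually.of_forall fun k => norm_nonneg _) hδ ?_
    filter_upwards [hN] with k h1
    rw [div_mul_eq_mul_div, le_div_iff₀ hc]
    refine le_trans (le_of_eq ?_) h1.1
    ring
  · have := hbound (fun k => ‖x k - x (k - 1)‖) (fun _ => 1) (ω / 2) N
      (Eventually.of_forall fun k => norm_nonneg _) (fun _ _ => one_pos)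
      (hN.mono fun k h1 => by simpa using h1.2)
    simpa using this

theorem tendsto_of_norm_sub_isBigO {X : Type*} [NormedAddCommGroup X] {x z : ℕ → X} {s : X}
    {σ : ℝ} (hσ : 0 < σ)
    (hz : Tendsto z atTop (𝓝 s))
    (h : (fun k : ℕ => ‖x k - z k‖) =O[atTop] (fun k : ℕ => 1 / (k : ℝ) ^ σ)) :
    Tendsto x atTop (𝓝 s) := by
  have h1 : Tendsto (fun k : ℕ => 1 / (k : ℝ) ^ σ) atTop (𝓝 0) :=
    tendsto_const_nhds.div_atTop ((tendsto_rpow_atTop hσ).comp tendsto_natCast_atTop_atTop)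
  have h2 := tendsto_zero_iff_norm_tendsto_zero.2 (h.trans_tendsto h1)
  simpa using h2.add hz

/-! ### The algorithm (IPGA) as an inertial scheme. -/

theorem tikhonovParam_eq {a h : ℝ} (hh : 0 < h) (p : ℝ) (k : ℕ) :
    tikhonovParam a h p k = a * h ^ (-p) * (k : ℝ) ^ (-p) := by
  rw [tikhonovParam, Real.mul_rpow (Nat.cast_nonneg k) hh.le]
  ring

theorem inertialParam_mul_eq_one {α a h q p : ℝ} (hα : 0 < α) (ha : 0 < a) (hh : 0 < h) {k : ℕ}
    (hk : 1 ≤ k) :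
    (1 + α * h * h ^ (-q) * (k : ℝ) ^ (-q) + h ^ 2 * tikhonovParam a h p k) *
      inertialParam α a h q p k = 1 := by
  have hk0 : (0 : ℝ) < k := by exact_mod_cast hk
  have hT : 0 < (k : ℝ) * h := by positivity
  have e1 : h ^ (-q) * (k : ℝ) ^ (-q) = (((k : ℝ) * h) ^ q)⁻¹ := by
    rw [← Real.rpow_neg hT.le, Real.mul_rpow hk0.le hh.le, mul_comm]
  rw [tikhonovParam, inertialParam, mul_assoc (α * h), e1, Real.rpow_neg hT.le, Real.rpow_add hT]
  field_simp

/-- Multiplying the proximal optimality condition by `1 / d_k` clears `d_k`. The summand `h² a_k` of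
`1 / d_k`, applied to `x_{k+1} - x_k`, turns the explicit Tikhonov term at `x_k` into an implicit
one at `x_{k+1}`. -/
theorem IsIPGASequence.isInertialScheme {g : X → ℝ} {α a β h q p : ℝ} {δ : ℕ → ℝ} {s : X}
    {z x : ℕ → X} (hx : IsIPGASequence g α a β h q p δ x)
    (hg_conv : ConvexOn ℝ Set.univ g) (hg_diff : Differentiable ℝ g)
    (hα : 0 < α) (ha : 0 < a) (hβ : 0 < β) (hh : 0 < h)
    (hq0 : 0 < q) (hq1 : q < 1) (hp1 : 1 < p) (hδ_pos : ∀ k : ℕ, 1 ≤ k → 0 < δ k)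
    (hδ_mono : ∀ k : ℕ, 1 ≤ k → δ k ≤ δ (k + 1)) (hδ_lim : Tendsto δ atTop atTop)
    (hδ_growth : GrowthCondition p δ) (hs : s ∈ argminSet g)
    (hz : ∀ k : ℕ, 1 ≤ k → IsTikhonovPoint g (tikhonovParam a h p k / δ k) (z k)) :
    IsInertialScheme g (β * h) (h ^ 2 * (a * h ^ (-p))) (α * h * h ^ (-q)) p q
      (fun k => h ^ 2 * δ k) s z x where
  convex := hg_conv
  differentiable := hg_diff
  b_pos := by positivity
  cA_pos := by positivity
  cγ_pos := by positivity
  q_pos := hq0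
  one_lt_p := hp1
  q_le_p := by linarith
  D_pos k hk := mul_pos (by positivity) (hδ_pos k hk)
  D_mono k hk := mul_le_mul_of_nonneg_left (hδ_mono k hk) (by positivity)
  D_tendsto := hδ_lim.const_mul_atTop (by positivity)
  D_growth := by
    obtain ⟨C, hC, h1⟩ := hδ_growth.exists_le (by linarith) hδ_pos
    refine ⟨C, hC, h1.mono fun k hk => ?_⟩
    have := mul_le_mul_of_nonneg_left hk (by positivity : 0 ≤ h ^ 2)
    linarith
  mem_argmin := hs
  tikhonov k hk := by
    have e : h ^ 2 * (a * h ^ (-p)) * (k : ℝ) ^ (-p) / (h ^ 2 * δ k) =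
        tikhonovParam a h p k / δ k := by
      rw [tikhonovParam_eq hh, mul_assoc, mul_div_mul_left _ _ (by positivity)]
    rw [e]
    exact hz k hk
  recursion k hk := by
    have hd := inertialParam_mul_eq_one (p := p) (q := q) hα ha hh hk
    have hT : 0 < (k : ℝ) * h := mul_pos (by exact_mod_cast hk) hh
    have hd0 : 0 < inertialParam α a h q p k := by
      unfold inertialParam
      positivity
    have hρ : stepSize α a β h q p δ k ≠ 0 := by
      have := hδ_pos k hk
      unfold stepSize
      positivity
    have e := (hx k hk).gradient_eq hg_diff hρ
    rw [stepSize] at e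
    have eA : h ^ 2 * (a * h ^ (-p)) * (k : ℝ) ^ (-p) = h ^ 2 * tikhonovParam a h p k := by
      rw [tikhonovParam_eq hh, mul_assoc]
    rw [eA]
    set d := inertialParam α a h q p k
    set A := tikhonovParam a h p k
    set γ := α * h * h ^ (-q) * (k : ℝ) ^ (-q)
    have e1 := congrArg (fun y => (1 + γ + h ^ 2 * A) • y) e
    have e2 : (1 + γ + h ^ 2 * A) * (d * (β * h + h ^ 2 * δ k)) = β * h + h ^ 2 * δ k := by
      rw [← mul_assoc, hd, one_mul]
    have e3 : (1 + γ + h ^ 2 * A) * (h ^ 2 * d * A) = h ^ 2 * A := by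
      linear_combination (h ^ 2 * A) * hd
    simp only [smul_add, smul_sub, smul_smul, e2, e3, hd] at e1
    rw [← sub_eq_zero] at e1 ⊢
    rw [← neg_eq_zero, ← e1, ← sub_eq_zero]
    have e4 : (1 + γ + h ^ 2 * A) * (d * (β * h)) = β * h := by
      linear_combination (β * h) * hd
    simp only [e4]
    module

theorem tendsto_tikhonov_of_params {g : X → ℝ} (hg_conv : ConvexOn ℝ Set.univ g)
    (hg_diff : Differentiable ℝ g) {a h p : ℝ} (ha : 0 < a) (hh : 0 < h) (hp : 0 < p)
    {δ : ℕ → ℝ} (hδ_pos : ∀ k : ℕ, 1 ≤ k → 0 < δ k)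
    (hδ_mono : ∀ k : ℕ, 1 ≤ k → δ k ≤ δ (k + 1)) (hδ_lim : Tendsto δ atTop atTop) {s : X}
    (hs : IsMinNormSolution g s) {z : ℕ → X}
    (hz : ∀ k : ℕ, 1 ≤ k → IsTikhonovPoint g (tikhonovParam a h p k / δ k) (z k)) :
    Tendsto z atTop (𝓝 s) := by
  -- The hypotheses say nothing about index 0, so the path is shifted by one to satisfy positivity
  -- and monotonicity everywhere.
  rw [← tendsto_add_atTop_iff_nat 1]
  have hpos : ∀ k : ℕ, 0 < tikhonovParam a h p (k + 1) := fun k => by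
    unfold tikhonovParam
    positivity
  refine tendsto_of_isTikhonovPoint hg_conv hg_diff hs
    (fun k => div_pos (hpos k) (hδ_pos (k + 1) (Nat.le_add_left 1 k))) ?_ ?_
    (fun k => hz (k + 1) (Nat.le_add_left 1 k))
  · refine antitone_nat_of_succ_le fun k => ?_
    refine div_le_div₀ (hpos k).le ?_ (hδ_pos _ (Nat.le_add_left 1 k))
      (hδ_mono _ (Nat.le_add_left 1 k))
    unfold tikhonovParam
    refine mul_le_mul_of_nonneg_left ?_ ha.le
    refine Real.rpow_le_rpow_of_nonpos (by positivity) ?_ (by linarith)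
    gcongr
    exact Nat.le_succ _
  · have h1 : Tendsto (fun k : ℕ => tikhonovParam a h p k) atTop (𝓝 (a * 0)) :=
      ((tendsto_rpow_neg_atTop hp).comp
        (tendsto_natCast_atTop_atTop.atTop_mul_const hh)).const_mul a
    exact (tendsto_add_atTop_iff_nat 1).2 (h1.div_atTop hδ_lim)

end Rates

/-! ### The main theorem: choice of exponents in each regime. -/

theorem theorem4p2 {X : Type*} [NormedAddCommGroup X] [InnerProductSpace ℝ X] [CompleteSpace X]
    (g : X → ℝ) (hg_conv : ConvexOn ℝ Set.univ g) (hg_diff : Differentiable ℝ g)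
    (hg_sol : (argminSet g).Nonempty)
    (α a β h q p : ℝ) (hα : 0 < α) (ha : 0 < a) (hβ : 0 < β) (hh : 0 < h)
    (hq0 : 0 < q) (hq1 : q < 1) (hp1 : 1 < p) (hpq : p < q + 1)
    (δ : ℕ → ℝ) (hδ_pos : ∀ k : ℕ, 1 ≤ k → 0 < δ k)
    (hδ_mono : ∀ k : ℕ, 1 ≤ k → δ k ≤ δ (k + 1)) (hδ_lim : Tendsto δ atTop atTop)
    (hδ_growth : GrowthCondition p δ)
    (hδ_lower : ∃ c₀ : ℝ, 0 < c₀ ∧ ∀ k : ℕ, 1 ≤ k → c₀ * (k : ℝ) ^ (p - q) ≤ δ k ^ 2) :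
    (∃! z : X, IsMinNormSolution g z) ∧
    (∀ k : ℕ, 1 ≤ k → ∃! z : X, IsTikhonovPoint g (tikhonovParam a h p k / δ k) z) ∧
    ∀ (xstar : X) (xbar : ℕ → X) (x : ℕ → X),
      IsMinNormSolution g xstar →
      (∀ k : ℕ, 1 ≤ k → IsTikhonovPoint g (tikhonovParam a h p k / δ k) (xbar k)) →
      IsIPGASequence g α a β h q p δ x →
      Tendsto x atTop (𝓝 xstar) ∧
      (p < 2 * q →
        (fun k : ℕ => g (x k) - g xstar) =O[atTop] (fun k : ℕ => 1 / ((k : ℝ) ^ p * δ k)) ∧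
        (fun k : ℕ => ‖x k - xbar k‖) =O[atTop] (fun k : ℕ => 1 / (k : ℝ) ^ ((1 - q) / 2)) ∧
        (fun k : ℕ => ‖gradient g (x k)‖) =O[atTop]
          (fun k : ℕ => 1 / ((k : ℝ) ^ ((p - q + 1) / 2) * δ k)) ∧
        (fun k : ℕ => ‖x k - x (k - 1)‖) =O[atTop]
          (fun k : ℕ => 1 / (k : ℝ) ^ ((p - q + 1) / 2))) ∧
      (2 * q ≤ p → p < (3 * q + 1) / 2 →
        (fun k : ℕ => g (x k) - g xstar) =O[atTop] (fun k : ℕ => 1 / ((k : ℝ) ^ p * δ k)) ∧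
        (fun k : ℕ => ‖x k - xbar k‖) =O[atTop] (fun k : ℕ => 1 / (k : ℝ) ^ ((1 - q) / 2)) ∧
        (fun k : ℕ => ‖gradient g (x k)‖) =O[atTop]
          (fun k : ℕ => 1 / ((k : ℝ) ^ ((q + 1) / 2) * δ k)) ∧
        (fun k : ℕ => ‖x k - x (k - 1)‖) =O[atTop]
          (fun k : ℕ => 1 / (k : ℝ) ^ ((q + 1) / 2))) ∧
      ((3 * q + 1) / 2 ≤ p →
        (fun k : ℕ => ‖x k - xbar k‖) =O[atTop] (fun k : ℕ => 1 / (k : ℝ) ^ (q - p + 1)) ∧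
        (fun k : ℕ => ‖gradient g (x k)‖) =O[atTop]
          (fun k : ℕ => 1 / ((k : ℝ) ^ (2 * q - p + 1) * δ k)) ∧
        (fun k : ℕ => ‖x k - x (k - 1)‖) =O[atTop]
          (fun k : ℕ => 1 / (k : ℝ) ^ (2 * q - p + 1)) ∧
        (p < (4 * q + 2) / 3 →
          (fun k : ℕ => g (x k) - g xstar) =O[atTop]
            (fun k : ℕ => 1 / ((k : ℝ) ^ p * δ k))) ∧
        ((4 * q + 2) / 3 ≤ p →
          (fun k : ℕ => g (x k) - g xstar) =O[atTop]
            (fun k : ℕ => 1 / ((k : ℝ) ^ (4 * q - 2 * p + 2) * δ k)))) := by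
  refine ⟨existsUnique_isMinNormSolution hg_conv hg_diff.continuous hg_sol, fun k hk => ?_,
    fun xstar xbar x hs hz hx => ?_⟩
  · refine existsUnique_isTikhonovPoint hg_conv hg_diff.continuous hg_sol
      (div_pos ?_ (hδ_pos k hk))
    have : (0 : ℝ) < k := by exact_mod_cast hk
    unfold tikhonovParam
    positivity
  have hS := hx.isInertialScheme hg_conv hg_diff hα ha hβ hh hq0 hq1 hp1 hδ_pos hδ_mono hδ_lim
    hδ_growth hs.1 hz
  have hlim := tendsto_tikhonov_of_params hg_conv hg_diff ha hh (by linarith) hδ_pos hδ_mono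
    hδ_lim hs hz
  have hh2 : 0 < h ^ 2 := by positivity
  -- Here `q > p - q`, so the contraction exponent is `m = q`. The drift of the regularization
  -- determines `ω`, and the Tikhonov weight gives the distance rate.
  have h1 := fun hp : p < 2 * q => hS.isBigO_rates hh2 (m := q) (ω := 1 + p - q) (τ := p)
    (σ := (1 - q) / 2) (ρ := (p - q + 1) / 2) le_rfl (by linarith) hq1 (by linarith)
    (by linarith) (by linarith) (by linarith) (by linarith) le_rfl (Or.inl (by linarith))
    (by ring)
  -- Now `m = p - q`, and `1 + p - m = 1 + q` is still the smaller bound on `ω`; the distance rate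
  -- comes from the damping weight.
  have h2 := fun (hp : 2 * q ≤ p) (hp' : p < (3 * q + 1) / 2) =>
    hS.isBigO_rates hh2 (m := p - q) (ω := 1 + q) (τ := p)
    (σ := (1 - q) / 2) (ρ := (q + 1) / 2) (by linarith) (by linarith) (by linarith) (by linarith)
    (by linarith) (by linarith) (by linarith) (by linarith) le_rfl (Or.inr (by linarith))
    (by ring)
  -- The motion of the Tikhonov points now dominates: `2 + 2q - 2m = 4q - 2p + 2` is the smaller
  -- bound. The value exponent `τ` stays free, since `p ≤ 4q - 2p + 2` exactly when `p ≤ (4q + 2) /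
  -- 3`.
  have h3 := fun (hp : (3 * q + 1) / 2 ≤ p) (τ : ℝ) (hτ : τ ≤ 4 * q - 2 * p + 2) (hτp : τ ≤ p) =>
    hS.isBigO_rates hh2 (m := p - q) (ω := 4 * q - 2 * p + 2) (τ := τ)
    (σ := q - p + 1) (ρ := 2 * q - p + 1) (by linarith) (by linarith) (by linarith)
    (by linarith) (by linarith) (by linarith) (by linarith) hτ hτp (Or.inr (by linarith))
    (by ring)
  have h3' := fun hp => h3 hp (min p (4 * q - 2 * p + 2)) (min_le_right _ _) (min_le_left _ _)
  refine ⟨?_, h1, h2, fun hp => ⟨(h3' hp).2.1, (h3' hp).2.2.1, (h3' hp).2.2.2,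
    fun hp' => (h3 hp p (by linarith) le_rfl).1,
    fun hp' => (h3 hp (4 * q - 2 * p + 2) le_rfl (by linarith)).1⟩⟩
  rcases lt_or_ge p (2 * q) with hp | hp
  · exact tendsto_of_norm_sub_isBigO (by linarith) hlim (h1 hp).2.1
  · rcases lt_or_ge p ((3 * q + 1) / 2) with hp' | hp'
    · exact tendsto_of_norm_sub_isBigO (by linarith) hlim (h2 hp hp').2.1
    · exact tendsto_of_norm_sub_isBigO (by linarith) hlim (h3' hp').2.1
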